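/- **Setting.** Let $n\ge 1$. A first class polynomial Poisson algebra on generators $G_1,\dots,G_n$ is a Poisson bracket on $\mathbb C[G_1,\dots,G_n]$, extended as a biderivation from polynomials $[G_a,G_b]$ lying in the ideal $(G_1,\dots,G_n)$; it is called quadratic if every $[G_a,G_b]$ is homogeneous of degree $2$. Adjoin anticommuting variables $\eta^a$ (ghosts) and $\mathcal P_a$ (ghost momenta), $a=1,\dots,n$, and on the algebra of polynomials in $G_a,\eta^a,\mathcal P_a$ put $[F,H]_{\rm orig}=\sum_{a,b}\frac{\partial F}{\partial G_a}\frac{\partial H}{\partial G_b}[G_a,G_b]$ and, with left derivatives and $\epsilon_F$ the Grassmann parity of $F$, $[F,H]_{\mathcal P,\eta}=(-1)^{\epsilon_F}\sum_a\Big(\frac{\partial F}{\partial\eta^a}\frac{\partial H}{\partial\mathcal P_a}+\frac{\partial F}{\partial\mathcal P_a}\frac{\partial H}{\partial\eta^a}\Big)$, so that $[\mathcal P_a,\eta^b]=-\delta_a{}^b$. The full bracket is $[F,H]=[F,H]_{\rm orig}+[F,H]_{\mathcal P,\eta}$. Let $\sigma=-\sum_a\mathcal P_a\,\partial/\partial G_a$.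 The covariant BRST charge is $\Omega=\sum_{k=0}^{n-1}\Omega^{(k)}$, where $\Omega^{(0)}=\sum_a G_a\eta^a$ and $$\Omega^{(p+1)}=-\sum_{m\ge1}\frac1m\,\sigma\big(D^{(p)}_m\big),\qquad D^{(p)}=\frac12\Big[\sum_{k=0}^{p}[\Omega^{(k)},\Omega^{(p-k)}]_{\rm orig}+\sum_{k=0}^{p-1}[\Omega^{(k+1)},\Omega^{(p-k)}]_{\mathcal P,\eta}\Big],$$ $D^{(p)}_m$ being the component of $D^{(p)}$ of total degree $m$ in the $G$'s and $\mathcal P$'s. The covariant rank of the algebra is the degree of $\Omega$ in the $\mathcal P$'s. **Statement.** There is a real sequence $(\alpha_k)_{k\ge1}$, independent of $n$, with $$\alpha_1=-\tfrac12,\quad \alpha_2=-\tfrac1{12},\quad \alpha_3=0,\qquad \alpha_k=-\frac1{k+1}\sum_{l=1}^{k-3}\alpha_{l+1}\,\alpha_{k-l-1}\quad(k>3),$$ such that $\alpha_k=0$ for all odd $k>1$, $\alpha_k<0$ for all even $k>0$, and the following holds. For every $n\ge1$ the brackets $$[G_1,G_\alpha]=G_1G_\alpha=-[G_\alpha,G_1]\quad(\alpha=2,\dots,n),\qquad\text{all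 other }[G_a,G_b]=0,$$ define a quadratic first class Poisson algebra, whose covariant BRST charge is given by $\Omega^{(0)}=\sum_a\eta^aG_a$ and, for all $k\ge1$, $$\Omega^{(k)}=\alpha_k\big(T_1^{(k)}+(-1)^{k+1}T_2^{(k)}\big),$$ $$T_1^{(k)}=\sum_{\alpha_1,\dots,\alpha_k=2}^{n} G_1\,\eta^{\alpha_1}\cdots\eta^{\alpha_k}\eta^1\,\mathcal P_{\alpha_1}\cdots\mathcal P_{\alpha_k},\qquad T_2^{(k)}=\sum_{\alpha_1,\dots,\alpha_k=2}^{n} G_{\alpha_k}\,\eta^{\alpha_1}\cdots\eta^{\alpha_k}\eta^1\,\mathcal P_1\mathcal P_{\alpha_1}\cdots\mathcal P_{\alpha_{k-1}}.$$ Moreover $\Omega^{(k)}=0$ for $k\ge n$; $[\Omega,\Omega]=0$; and for every even $k$ with $0\le k\le n-1$ one has $\Omega^{(k)}\neq0$ and the covariant rank is at least $k$. In particular, for every $r$ there is an $n$ for which the covariant rank of this algebra is at least $r$: quadratic Poisson algebras have arbitrarily high covariant rank. -/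

import Mathlib

open scoped TensorProduct

noncomputable section

namespace PoissonBRST

/-! ### Polynomial Poisson algebras on the generators `G_1, …, G_n` -/

/-- The algebra `ℂ(G_a)` of polynomials in the generators `G_a`. -/
abbrev GenPoly (n : ℕ) : Type := MvPolynomial (Fin n) ℂ

/-- The biderivation of `ℂ(G_a)` with `[G_a, G_b] = c a b`. -/
def polyBracket {n : ℕ} (c : Fin n → Fin n → GenPoly n) (f g : GenPoly n) : GenPoly n :=
  ∑ a, ∑ b, MvPolynomial.pderiv a f * MvPolynomial.pderiv b g * c a b

/-- The brackets `[G_a, G_b] = c a b` define a first class polynomial Poisson algebra: they are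
antisymmetric, satisfy the Jacobi identity, and lie in the ideal generated by the `G`'s. -/
structure IsFirstClassPoisson {n : ℕ} (c : Fin n → Fin n → GenPoly n) : Prop where
  antisymm : ∀ a b, c a b = -c b a
  jacobi : ∀ f g h : GenPoly n,
    polyBracket c (polyBracket c f g) h + polyBracket c (polyBracket c g h) f
      + polyBracket c (polyBracket c h f) g = 0
  firstClass : ∀ a b, c a b ∈ Ideal.span (Set.range (MvPolynomial.X : Fin n → GenPoly n))

/-- The brackets of the generators are homogeneous quadratic polynomials in the generators. -/
def IsQuadratic {n : ℕ} (c : Fin n → Fin n → GenPoly n) : Prop :=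
  ∀ a b, (c a b).IsHomogeneous 2

/-! ### The extended algebra `ℂ(P_a) ⊗ ℂ(G_a) ⊗ ℂ(η^a)` -/

/-- The algebra of polynomials in the anticommuting variables `η^a` and `P_a`: the exterior
algebra on `2n` generators (`Sum.inl a` is the index of `η^a`, `Sum.inr a` the one of `P_a`). -/
abbrev GhostAlg (n : ℕ) : Type := ExteriorAlgebra ℂ (Fin n ⊕ Fin n → ℂ)

/-- Polynomials in the commuting `G_a` and the anticommuting `η^a`, `P_a`. -/
abbrev ExtAlg (n : ℕ) : Type := GenPoly n ⊗[ℂ] GhostAlg n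

/-- The inclusion of the polynomials in the `G`'s. -/
def ofPoly {n : ℕ} (f : GenPoly n) : ExtAlg n := f ⊗ₜ[ℂ] (1 : GhostAlg n)

/-- The generator `G_a`. -/
def G {n : ℕ} (a : Fin n) : ExtAlg n := ofPoly (MvPolynomial.X a)

/-- The ghost `η^a`. -/
def eta {n : ℕ} (a : Fin n) : ExtAlg n :=
  (1 : GenPoly n) ⊗ₜ[ℂ] ExteriorAlgebra.ι ℂ (Pi.single (Sum.inl a) (1 : ℂ))

/-- The ghost momentum `P_a`. -/
def P {n : ℕ} (a : Fin n) : ExtAlg n :=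
  (1 : GenPoly n) ⊗ₜ[ℂ] ExteriorAlgebra.ι ℂ (Pi.single (Sum.inr a) (1 : ℂ))

/-- The derivative `∂/∂G_a`. -/
def dG {n : ℕ} (a : Fin n) : ExtAlg n →ₗ[ℂ] ExtAlg n :=
  TensorProduct.map (MvPolynomial.pderiv a).toLinearMap LinearMap.id

/-- The left derivative with respect to the odd variable with index `i`: the contraction with
the `i`-th coordinate form. -/
def dOdd {n : ℕ} (i : Fin n ⊕ Fin n) : ExtAlg n →ₗ[ℂ] ExtAlg n :=
  TensorProduct.map LinearMap.id
    (CliffordAlgebra.contractLeft (LinearMap.proj i : Module.Dual ℂ (Fin n ⊕ Fin n → ℂ)))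

/-- The left derivative `∂/∂η^a`. -/
def dEta {n : ℕ} (a : Fin n) : ExtAlg n →ₗ[ℂ] ExtAlg n := dOdd (Sum.inl a)

/-- The left derivative `∂/∂P_a`. -/
def dP {n : ℕ} (a : Fin n) : ExtAlg n →ₗ[ℂ] ExtAlg n := dOdd (Sum.inr a)

/-- The sign `F ↦ (-1)^{ε(F)} F`, where `ε` is the Grassmann parity. -/
def paritySign {n : ℕ} : ExtAlg n →ₗ[ℂ] ExtAlg n :=
  TensorProduct.map LinearMap.id (CliffordAlgebra.involute (R := ℂ)).toLinearMap

/-- The bracket acting on the `G`'s only. -/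
def origBracket {n : ℕ} (c : Fin n → Fin n → GenPoly n) (x y : ExtAlg n) : ExtAlg n :=
  ∑ a, ∑ b, dG a x * dG b y * ofPoly (c a b)

/-- The graded Poisson bracket acting on the ghosts and their momenta only,
`(-1)^{ε(x)} ∑ₐ (∂x/∂η^a ∂y/∂P_a + ∂x/∂P_a ∂y/∂η^a)`, so that `[P_a, η^b] = -δ_a^b`. -/
def ghostBracket {n : ℕ} (x y : ExtAlg n) : ExtAlg n :=
  ∑ a, (dEta a (paritySign x) * dP a y + dP a (paritySign x) * dEta a y)

/-- The graded Poisson bracket of the extended algebra. -/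
def extBracket {n : ℕ} (c : Fin n → Fin n → GenPoly n) (x y : ExtAlg n) : ExtAlg n :=
  origBracket c x y + ghostBracket x y

/-! ### Degrees -/

/-- On linear forms in the odd variables: keep `η^a` and replace `P_a` by `t P_a`. -/
def momentumScaleLin (n : ℕ) : (Fin n ⊕ Fin n → ℂ) →ₗ[ℂ] Polynomial (GhostAlg n) where
  toFun v :=
    Polynomial.C (ExteriorAlgebra.ι ℂ (Sum.elim (fun a => v (Sum.inl a)) (fun _ => 0)))
      + Polynomial.C (ExteriorAlgebra.ι ℂ (Sum.elim (fun _ => 0) (fun a => v (Sum.inr a))))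
        * Polynomial.X
  map_add' v w := by
    have h1 : (Sum.elim (fun a => (v + w) (Sum.inl a)) (fun _ => 0) : Fin n ⊕ Fin n → ℂ)
        = Sum.elim (fun a => v (Sum.inl a)) (fun _ => 0)
          + Sum.elim (fun a => w (Sum.inl a)) (fun _ => 0) := by
      ext (i | i) <;> simp
    have h2 : (Sum.elim (fun _ => 0) (fun a => (v + w) (Sum.inr a)) : Fin n ⊕ Fin n → ℂ)
        = Sum.elim (fun _ => 0) (fun a => v (Sum.inr a))
          + Sum.elim (fun _ => 0) (fun a => w (Sum.inr a)) := by
      ext (i | i) <;> simp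
    rw [h1, h2]
    simp only [map_add, add_mul]
    abel
  map_smul' r v := by
    have h1 : (Sum.elim (fun a => (r • v) (Sum.inl a)) (fun _ => 0) : Fin n ⊕ Fin n → ℂ)
        = r • Sum.elim (fun a => v (Sum.inl a)) (fun _ => 0) := by
      ext (i | i) <;> simp
    have h2 : (Sum.elim (fun _ => 0) (fun a => (r • v) (Sum.inr a)) : Fin n ⊕ Fin n → ℂ)
        = r • Sum.elim (fun _ => 0) (fun a => v (Sum.inr a)) := by
      ext (i | i) <;> simp
    rw [h1, h2]
    simp only [map_smul, RingHom.id_apply, smul_add, ← Polynomial.smul_C, smul_mul_assoc]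

theorem momentumScaleLin_sq {n : ℕ} (v : Fin n ⊕ Fin n → ℂ) :
    momentumScaleLin n v * momentumScaleLin n v = 0 := by
  have key : ∀ a b : GhostAlg n, a * a = 0 → b * b = 0 → a * b + b * a = 0 →
      (Polynomial.C a + Polynomial.C b * Polynomial.X)
        * (Polynomial.C a + Polynomial.C b * Polynomial.X) = 0 := by
    intro a b ha hb hab
    have hX : (Polynomial.X : Polynomial (GhostAlg n)) * Polynomial.C a
        = Polynomial.C a * Polynomial.X := Polynomial.X_mul_C a
    have hX' : (Polynomial.X : Polynomial (GhostAlg n)) * Polynomial.C b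
        = Polynomial.C b * Polynomial.X := Polynomial.X_mul_C b
    calc (Polynomial.C a + Polynomial.C b * Polynomial.X)
          * (Polynomial.C a + Polynomial.C b * Polynomial.X)
        = Polynomial.C (a * a) + Polynomial.C (a * b + b * a) * Polynomial.X
            + Polynomial.C (b * b) * Polynomial.X * Polynomial.X := by
          simp only [add_mul, mul_add, Polynomial.C_mul, Polynomial.C_add, mul_assoc, hX]
          rw [← mul_assoc Polynomial.X (Polynomial.C b), hX']
          simp only [mul_assoc]
          abel
      _ = 0 := by simp [ha, hb, hab]
  exact key _ _ (ExteriorAlgebra.ι_sq_zero _) (ExteriorAlgebra.ι_sq_zero _)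
    (ExteriorAlgebra.ι_add_mul_swap _ _)

/-- The algebra morphism that keeps the `η^a` and replaces `P_a` by `t P_a`. -/
def momentumScale (n : ℕ) : GhostAlg n →ₐ[ℂ] Polynomial (GhostAlg n) :=
  ExteriorAlgebra.lift ℂ ⟨momentumScaleLin n, momentumScaleLin_sq⟩

/-- The component of degree `j` in the momenta `P_a`, on the ghost algebra: the coefficient of
`t^j` after replacing `P_a` by `t P_a`. -/
def ghostMomentumPart {n : ℕ} (j : ℕ) : GhostAlg n →ₗ[ℂ] GhostAlg n where
  toFun x := (momentumScale n x).coeff j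
  map_add' x y := by simp
  map_smul' r x := by simp

/-- The component of degree `j` in the ghost momenta `P_a`. -/
def momentumPart {n : ℕ} (j : ℕ) : ExtAlg n →ₗ[ℂ] ExtAlg n :=
  TensorProduct.map LinearMap.id (ghostMomentumPart j)

/-- The component of total degree `m` in the `G`'s and the `P`'s. -/
def degreePart {n : ℕ} (m : ℕ) : ExtAlg n →ₗ[ℂ] ExtAlg n :=
  ∑ ij ∈ Finset.HasAntidiagonal.antidiagonal m,
    TensorProduct.map (MvPolynomial.homogeneousComponent ij.1) (ghostMomentumPart ij.2)

/-- An element has only finitely many nonzero components. -/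
theorem finite_support_degreePart {n : ℕ} (x : ExtAlg n) :
    {m : ℕ | degreePart m x ≠ 0}.Finite := by
  induction x using TensorProduct.induction_on with
  | zero => simp
  | tmul f e =>
    refine (Set.finite_Iic (f.totalDegree + (momentumScale n e).natDegree)).subset ?_
    intro m hm
    by_contra hlt
    simp only [Set.mem_Iic, not_le] at hlt
    apply hm
    simp only [degreePart, LinearMap.sum_apply, TensorProduct.map_tmul]
    refine Finset.sum_eq_zero fun ij hij => ?_
    have hsum := Finset.HasAntidiagonal.mem_antidiagonal.1 hij
    by_cases h : f.totalDegree < ij.1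
    · rw [MvPolynomial.homogeneousComponent_eq_zero _ _ h, TensorProduct.zero_tmul]
    · have h2 : (momentumScale n e).natDegree < ij.2 := by omega
      have h3 : ghostMomentumPart ij.2 e = 0 := Polynomial.coeff_eq_zero_of_natDegree_lt h2
      rw [h3, TensorProduct.tmul_zero]
  | add x y hx hy =>
    refine (hx.union hy).subset ?_
    intro m hm
    by_contra h
    simp only [Set.mem_union, Set.mem_ofPred_eq, not_or, not_not] at h
    exact hm (by rw [map_add, h.1, h.2, add_zero])

/-! ### The covariant BRST charge -/

/-- The homotopy `σ = - P_a ∂/∂G_a`. -/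
def homotopy {n : ℕ} (x : ExtAlg n) : ExtAlg n := -∑ a, P a * dG a x

/-- `∑_m (1/m) σ D_m`, where `D_m` is the component of degree `m` of `D` in `(G, P)`.
The sum is finite, and `σ D_0 = 0`, so that the value given to `1/0` is immaterial. -/
def weightedHomotopy {n : ℕ} (D : ExtAlg n) : ExtAlg n :=
  ∑ᶠ m : ℕ, ((m : ℂ)⁻¹) • homotopy (degreePart m D)

/-- `D^(p) = ½ (∑_{k=0}^{p} [Ω^(k), Ω^(p-k)]_orig + ∑_{k=0}^{p-1} [Ω^(k+1), Ω^(p-k)]_{P,η})`. -/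
def obstruction {n : ℕ} (c : Fin n → Fin n → GenPoly n) (Ω : ℕ → ExtAlg n) (p : ℕ) : ExtAlg n :=
  (1 / 2 : ℂ) • (∑ k : Fin (p + 1), origBracket c (Ω (k : ℕ)) (Ω (p - (k : ℕ)))
    + ∑ k : Fin p, ghostBracket (Ω ((k : ℕ) + 1)) (Ω (p - (k : ℕ))))

/-- The terms `Ω^(k)` of the covariant BRST charge: `Ω^(0) = G_a η^a` and
`Ω^(p+1) = - ∑_m (1/m) σ D^(p)_m` (see `covariantOmega_succ`). -/
def covariantOmega {n : ℕ} (c : Fin n → Fin n → GenPoly n) : ℕ → ExtAlg n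
  | 0 => ∑ a, G a * eta a
  | p + 1 => -weightedHomotopy ((1 / 2 : ℂ) •
      (∑ k : Fin (p + 1), origBracket c (covariantOmega c (k : ℕ)) (covariantOmega c (p - (k : ℕ)))
        + ∑ k : Fin p, ghostBracket (covariantOmega c ((k : ℕ) + 1)) (covariantOmega c (p - (k : ℕ)))))
  decreasing_by all_goals omega

theorem covariantOmega_zero {n : ℕ} (c : Fin n → Fin n → GenPoly n) :
    covariantOmega c 0 = ∑ a, G a * eta a := by
  rw [covariantOmega]

theorem covariantOmega_succ {n : ℕ} (c : Fin n → Fin n → GenPoly n) (p : ℕ) :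
    covariantOmega c (p + 1) = -weightedHomotopy (obstruction c (covariantOmega c) p) := by
  rw [covariantOmega, obstruction]

/-- The covariant BRST charge `Ω = Ω^(0) + Ω^(1) + ⋯ + Ω^(n-1)`. -/
def covariantCharge {n : ℕ} (c : Fin n → Fin n → GenPoly n) : ExtAlg n :=
  ∑ k ∈ Finset.range n, covariantOmega c k

/-- The degree of an element in the ghost momenta. -/
def momentumDegree {n : ℕ} (x : ExtAlg n) : ℕ := sSup {j : ℕ | momentumPart j x ≠ 0}

/-- The covariant rank: the degree of the covariant BRST charge in the ghost momenta. -/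
def covariantRank {n : ℕ} (c : Fin n → Fin n → GenPoly n) : ℕ :=
  momentumDegree (covariantCharge c)

/-! ### The self-reproducing algebra with one distinguished generator

There are `m + 1` generators: `G_1` has index `0`, and `G_2, …, G_{m+1}` have the indices
`Fin.succ i`. -/

/-- `[G_1, G_α] = G_1 G_α = -[G_α, G_1]` for `α ≥ 2`; all other brackets vanish. -/
def selfRep (m : ℕ) (a b : Fin (m + 1)) : GenPoly (m + 1) :=
  if a = 0 ∧ b ≠ 0 then MvPolynomial.X a * MvPolynomial.X b
  else if a ≠ 0 ∧ b = 0 then -(MvPolynomial.X b * MvPolynomial.X a)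
  else 0

/-- `T₁^(k) = G_1 η^{α_1} ⋯ η^{α_k} η^1 P_{α_1} ⋯ P_{α_k}`, summed over
`α_1, …, α_k ≥ 2`. -/
def T1 (m k : ℕ) : ExtAlg (m + 1) :=
  ∑ α : Fin k → Fin m,
    G 0 * (List.ofFn fun i => eta (α i).succ).prod * eta 0
      * (List.ofFn fun i => P (α i).succ).prod

/-- `T₂^(k) = G_{α_k} η^{α_1} ⋯ η^{α_k} η^1 P_1 P_{α_1} ⋯ P_{α_{k-1}}`, summed over
`α_1, …, α_k ≥ 2`; it is defined for `k ≥ 1`, and here `k = l + 1`. -/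
def T2 (m l : ℕ) : ExtAlg (m + 1) :=
  ∑ α : Fin (l + 1) → Fin m,
    G (α (Fin.last l)).succ * (List.ofFn fun i => eta (α i).succ).prod * eta 0
      * P 0 * (List.ofFn fun i : Fin l => P (α i.castSucc).succ).prod

end PoissonBRST

end

/-!
Write `N = ∑_{α ≥ 2} η^α P_α` (even, hence central) and `S = ∑_{α ≥ 2} G_α η^α` (odd, `S² = 0`),
and put `W_l = η^1 N^l (G_1 N + S P_1)` and `X_p = G_1 η^1 S N^p`. Reordering the odd variables
turns `T₁^(l+1) + (-1)^(l+2) T₂^(l+1)` into `(-1)^(k(k+1)/2) W_l` with `k = l + 1` (`T1_add_T2`),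
so that the claim is `Ω^(l+1) = β_(l+1) W_l` with `β_k = (-1)^(k(k+1)/2) α_k`
(`covariantOmega_selfRep`).

All brackets among `Ω^(0)` and the `W_l` are multiples of the `X_p`. Since `(η^1)² = 0`, the
brackets `[W_i, W_j]_orig` vanish and only the pair `(η^1, P_1)` contributes to the ghost bracket
`[W_i, W_j] = -2 X_(i+j+1)`, while `[Ω^(0), W_l]_orig = X_(l+1)`. Moreover `σ X_p = -W_p`, and
`X_p` has degree `p + 2` in the `G`'s and `P`'s. The recursion for `Ω` is therefore equivalent to
the scalar recurrence `(p + 2) β_(p+1) = β_p - ∑_{k < p} β_(k+1) β_(p-k)`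
(`betaCoeff_recurrence`), which is the differential equation `x b' = b - b² + x b` of
`b = x / (1 - e^(-x))`; since `β_1 = 1/2`, its extreme terms cancel against `β_p`, and what
remains is the recurrence for the `α_k`. The ghost bracket with `Ω^(0)` is minus the Koszul
differential `∑ G_a ∂/∂P_a`, which maps `W_l` to `(l + 2) X_l`, so the same recurrence makes the
coefficient of every `X_p` in `[Ω, Ω]` vanish for `p < m`, where `n = m + 1`. For `p ≥ m` one has
`X_p = 0`: among `m + 1` ghosts `η^α` with `α ≥ 2` two coincide, hence `N^(m+1) = 0`, and the
Koszul differential of this identity is `S N^m = 0` up to a factor.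

For `l < m` the element `W_l` is nonzero: its derivative with respect to `G_1` is `η^1 N^(l+1)`,
and each further `∂/∂P_α` trades a factor `N` for a ghost `η^α`, which leads to a product of
distinct ghosts. As `W_l` has degree `l + 1` in the momenta, different `Ω^(k)` cannot cancel,
which bounds the rank from below. The Jacobi identity holds because the bracket is the wedge of
the commuting derivations `G_1 ∂/∂G_1` and `∑_{α ≥ 2} G_α ∂/∂G_α`.
-/

open scoped TensorProduct

noncomputable section

namespace PoissonBRST

variable {n m : ℕ}

/-! ### Derivations and antiderivations of the extended algebra -/

theorem dG_mul (a : Fin n) (x y : ExtAlg n) : dG a (x * y) = dG a x * y + x * dG a y := by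
  induction x using TensorProduct.induction_on with
  | zero => simp
  | add x x' hx hx' => simp only [add_mul, map_add, hx, hx']; abel
  | tmul f e =>
    induction y using TensorProduct.induction_on with
    | zero => simp
    | add y y' hy hy' => simp only [mul_add, map_add, hy, hy']; abel
    | tmul g e' =>
      simp only [dG, Algebra.TensorProduct.tmul_mul_tmul, TensorProduct.map_tmul,
        LinearMap.id_apply, Derivation.coeFn_coe,
        Derivation.leibniz, smul_eq_mul, TensorProduct.add_tmul]
      rw [add_comm, mul_comm g]

/-- On the exterior algebra, contraction with a linear form is an antiderivation. -/
theorem contractLeft_mul {M : Type*} [AddCommGroup M] [Module ℂ M] (d : Module.Dual ℂ M)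
    (x y : ExteriorAlgebra ℂ M) :
    CliffordAlgebra.contractLeft d (x * y)
      = CliffordAlgebra.contractLeft d x * y
        + CliffordAlgebra.involute x * CliffordAlgebra.contractLeft d y := by
  induction x using CliffordAlgebra.left_induction with
  | algebraMap r =>
    rw [CliffordAlgebra.contractLeft_algebraMap_mul, CliffordAlgebra.contractLeft_algebraMap]
    simp
  | add x x' hx hx' => simp only [add_mul, map_add, hx, hx']; abel
  | ι_mul x m hx =>
    rw [mul_assoc, CliffordAlgebra.contractLeft_ι_mul, CliffordAlgebra.contractLeft_ι_mul, hx,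
      map_mul, CliffordAlgebra.involute_ι, mul_add, sub_mul, smul_mul_assoc]
    simp only [neg_mul, mul_assoc]
    abel

theorem dOdd_mul (i : Fin n ⊕ Fin n) (x y : ExtAlg n) :
    dOdd i (x * y) = dOdd i x * y + paritySign x * dOdd i y := by
  induction x using TensorProduct.induction_on with
  | zero => simp
  | add x x' hx hx' => simp only [add_mul, map_add, hx, hx']; abel
  | tmul f e =>
    induction y using TensorProduct.induction_on with
    | zero => simp
    | add y y' hy hy' => simp only [mul_add, map_add, hy, hy']; abel
    | tmul g e' =>
      simp only [dOdd, paritySign, Algebra.TensorProduct.tmul_mul_tmul, TensorProduct.map_tmul,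
        LinearMap.id_apply, contractLeft_mul, TensorProduct.tmul_add, AlgHom.toLinearMap_apply]

theorem paritySign_mul (x y : ExtAlg n) :
    paritySign (x * y) = paritySign x * paritySign y := by
  induction x using TensorProduct.induction_on with
  | zero => simp
  | add x x' hx hx' => simp only [add_mul, map_add, hx, hx']
  | tmul f e =>
    induction y using TensorProduct.induction_on with
    | zero => simp
    | add y y' hy hy' => simp only [mul_add, map_add, hy, hy']
    | tmul g e' =>
      simp only [paritySign, Algebra.TensorProduct.tmul_mul_tmul, TensorProduct.map_tmul,
        LinearMap.id_apply, AlgHom.toLinearMap_apply, map_mul]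

/-! The general lemmas `neg_mul`, `mul_neg` and `sub_mul` do not rewrite in `ExtAlg n`, because the
negation of a tensor product is found through its additive structure; these copies do. -/

@[simp] theorem ext_neg_mul (x y : ExtAlg n) : -x * y = -(x * y) := neg_mul x y

@[simp] theorem ext_mul_neg (x y : ExtAlg n) : x * -y = -(x * y) := mul_neg x y

theorem ext_sub_mul (x y z : ExtAlg n) : (x - y) * z = x * z - y * z := sub_mul x y z

/-- The odd generator with index `i`, which is `η^a` for `i = inl a` and `P_a` for `i = inr a`. -/
def odd (i : Fin n ⊕ Fin n) : ExtAlg n :=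
  (1 : GenPoly n) ⊗ₜ[ℂ] ExteriorAlgebra.ι ℂ (Pi.single i (1 : ℂ))

theorem eta_eq_odd (a : Fin n) : eta a = odd (Sum.inl a) := rfl

theorem P_eq_odd (a : Fin n) : P a = odd (Sum.inr a) := rfl

theorem odd_mul_self (i : Fin n ⊕ Fin n) : odd i * odd i = 0 := by
  simp [odd, Algebra.TensorProduct.tmul_mul_tmul]

/-- An odd generator commutes with every element up to the parity sign. -/
theorem odd_mul (i : Fin n ⊕ Fin n) (x : ExtAlg n) : odd i * x = paritySign x * odd i := by
  induction x using TensorProduct.induction_on with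
  | zero => simp
  | add x x' hx hx' => simp only [add_mul, mul_add, map_add, hx, hx']
  | tmul f e =>
    simp only [odd, paritySign, Algebra.TensorProduct.tmul_mul_tmul, TensorProduct.map_tmul,
        LinearMap.id_apply, AlgHom.toLinearMap_apply, one_mul, mul_one]
    congr 1
    induction e using CliffordAlgebra.left_induction with
    | algebraMap r => rw [AlgHom.commutes]; exact (Algebra.commutes r _).symm
    | add x x' hx hx' => simp only [add_mul, mul_add, map_add, hx, hx']
    | ι_mul x m hx =>
      rw [← mul_assoc, map_mul, CliffordAlgebra.involute_ι, mul_assoc _ _ (ExteriorAlgebra.ι ℂ _),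
        ← hx, neg_mul, ← mul_assoc, ← neg_mul]
      congr 1
      exact eq_neg_of_add_eq_zero_left (ExteriorAlgebra.ι_add_mul_swap _ _)

theorem odd_mul_mul_odd_mul (i : Fin n ⊕ Fin n) (x y : ExtAlg n) :
    odd i * x * (odd i * y) = 0 := by
  rw [odd_mul, mul_assoc, ← mul_assoc (odd i), odd_mul_self, zero_mul, mul_zero]

theorem commute_ofPoly (f : GenPoly n) (x : ExtAlg n) : Commute (ofPoly f) x := by
  induction x using TensorProduct.induction_on with
  | zero => simp
  | add x x' hx hx' => exact hx.add_right hx'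
  | tmul g e =>
    simp [Commute, SemiconjBy, ofPoly, Algebra.TensorProduct.tmul_mul_tmul, mul_comm]

theorem commute_G (a : Fin n) (x : ExtAlg n) : Commute (G a) x := commute_ofPoly _ x

@[simp] theorem paritySign_odd (i : Fin n ⊕ Fin n) : paritySign (odd i) = -odd i := by
  simp [paritySign, odd, TensorProduct.tmul_neg, ExteriorAlgebra.ι]

theorem paritySign_paritySign (x : ExtAlg n) : paritySign (paritySign x) = x := by
  induction x using TensorProduct.induction_on with
  | zero => simp
  | add x x' hx hx' => simp only [map_add, hx, hx']
  | tmul f e => simp [paritySign]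

@[simp] theorem paritySign_ofPoly (f : GenPoly n) : paritySign (ofPoly f) = ofPoly f := by
  simp [paritySign, ofPoly]

@[simp] theorem paritySign_one : paritySign (1 : ExtAlg n) = 1 := paritySign_ofPoly 1

@[simp] theorem paritySign_G (a : Fin n) : paritySign (G a) = G a := paritySign_ofPoly _

theorem paritySign_pow (x : ExtAlg n) (k : ℕ) : paritySign (x ^ k) = paritySign x ^ k := by
  induction k with
  | zero => simp
  | succ k ih => rw [pow_succ, paritySign_mul, ih, pow_succ]

theorem dOdd_odd (i j : Fin n ⊕ Fin n) : dOdd i (odd j) = if i = j then 1 else 0 := by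
  simp only [dOdd, odd, TensorProduct.map_tmul, ExteriorAlgebra.ι,
    CliffordAlgebra.contractLeft_ι, LinearMap.id_apply, LinearMap.proj_apply, Pi.single_apply]
  split_ifs
  · simp [Algebra.TensorProduct.one_def]
  · simp

@[simp] theorem dOdd_odd_self (i : Fin n ⊕ Fin n) : dOdd i (odd i) = 1 := by
  rw [dOdd_odd, if_pos rfl]

theorem dOdd_odd_of_ne {i j : Fin n ⊕ Fin n} (h : i ≠ j) : dOdd i (odd j) = 0 := by
  rw [dOdd_odd, if_neg h]

@[simp] theorem dOdd_ofPoly (i : Fin n ⊕ Fin n) (f : GenPoly n) : dOdd i (ofPoly f) = 0 := by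
  simp [dOdd, ofPoly]

@[simp] theorem dOdd_one (i : Fin n ⊕ Fin n) : dOdd i (1 : ExtAlg n) = 0 := dOdd_ofPoly i 1

@[simp] theorem dOdd_G (i : Fin n ⊕ Fin n) (a : Fin n) : dOdd i (G a) = 0 := dOdd_ofPoly _ _

theorem dOdd_odd_mul (i j : Fin n ⊕ Fin n) (x : ExtAlg n) :
    dOdd i (odd j * x) = (if i = j then x else 0) - odd j * dOdd i x := by
  rw [dOdd_mul, dOdd_odd, paritySign_odd, ext_neg_mul, ← sub_eq_add_neg, ite_mul, one_mul,
    zero_mul]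

theorem dOdd_G_mul (i : Fin n ⊕ Fin n) (a : Fin n) (x : ExtAlg n) :
    dOdd i (G a * x) = G a * dOdd i x := by
  rw [dOdd_mul, dOdd_G, zero_mul, zero_add, paritySign_G]

@[simp] theorem dG_odd (a : Fin n) (i : Fin n ⊕ Fin n) : dG a (odd i) = 0 := by
  simp [dG, odd]

@[simp] theorem dG_one (a : Fin n) : dG a 1 = 0 := by
  simp [dG, Algebra.TensorProduct.one_def]

theorem dG_odd_mul (a : Fin n) (i : Fin n ⊕ Fin n) (x : ExtAlg n) :
    dG a (odd i * x) = odd i * dG a x := by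
  rw [dG_mul, dG_odd, zero_mul, zero_add]

theorem dG_G (a b : Fin n) : dG a (G b) = if a = b then 1 else 0 := by
  simp only [dG, G, ofPoly, TensorProduct.map_tmul, Derivation.coeFn_coe, MvPolynomial.pderiv_X,
    Pi.single_apply, LinearMap.id_apply]
  simp only [eq_comm (a := b)]
  split_ifs
  · simp [Algebra.TensorProduct.one_def]
  · simp

theorem dG_pow_of_eq_zero {a : Fin n} {x : ExtAlg n} (h : dG a x = 0) (k : ℕ) :
    dG a (x ^ k) = 0 := by
  induction k with
  | zero => rw [pow_zero, dG_one]
  | succ k ih => rw [pow_succ, dG_mul, ih, h, zero_mul, mul_zero, add_zero]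

/-- An antiderivation acts on powers of an even element by the usual rule. -/
theorem dOdd_pow {i : Fin n ⊕ Fin n} {x : ExtAlg n} (hx : paritySign x = x)
    (hc : Commute x (dOdd i x)) (k : ℕ) :
    dOdd i (x ^ k) = (k : ℂ) • (dOdd i x * x ^ (k - 1)) := by
  induction k with
  | zero => simp
  | succ k ih =>
    rw [pow_succ', dOdd_mul, hx, ih, Nat.add_sub_cancel, mul_smul_comm, ← mul_assoc, hc.eq,
      mul_assoc, Nat.cast_succ, add_smul, one_smul, add_comm]
    cases k with
    | zero => simp
    | succ k => rw [Nat.add_sub_cancel, ← pow_succ']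

/-! ### Bilinearity of the brackets -/

theorem origBracket_selfRep {m : ℕ} (x y : ExtAlg (m + 1)) :
    origBracket (selfRep m) x y
      = ∑ i : Fin m, (dG 0 x * dG i.succ y - dG i.succ x * dG 0 y) * (G 0 * G i.succ) := by
  have h : ∀ i : Fin m, G (0 : Fin (m + 1)) * G i.succ
      = ofPoly (MvPolynomial.X 0 * MvPolynomial.X i.succ) := fun i => by
    simp [G, ofPoly, Algebra.TensorProduct.tmul_mul_tmul]
  have h0 : ofPoly (0 : GenPoly (m + 1)) = 0 := by simp [ofPoly]
  have hn : ∀ f : GenPoly (m + 1), ofPoly (-f) = -ofPoly f := fun f => by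
    simp [ofPoly, TensorProduct.neg_tmul]
  simp only [origBracket, Fin.sum_univ_succ, selfRep, Fin.succ_ne_zero, ne_eq, not_true_eq_false,
    and_false, and_true, not_false_eq_true, if_true, if_false, h0, hn, mul_zero,
    Finset.sum_const_zero, zero_add, add_zero, ext_mul_neg, h, ext_sub_mul, Finset.sum_sub_distrib,
    Finset.sum_neg_distrib, sub_eq_add_neg (∑ i : Fin m, _)]

/-- The bracket of the extended algebra, as a bilinear map. -/
def extBracketₗ (c : Fin n → Fin n → GenPoly n) : ExtAlg n →ₗ[ℂ] ExtAlg n →ₗ[ℂ] ExtAlg n :=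
  LinearMap.mk₂ ℂ (extBracket c)
    (by intros; simp only [extBracket, origBracket, ghostBracket, map_add, add_mul,
          Finset.sum_add_distrib]; abel)
    (by intros; simp only [extBracket, origBracket, ghostBracket, map_smul, smul_mul_assoc,
          Finset.smul_sum, smul_add])
    (by intros; simp only [extBracket, origBracket, ghostBracket, map_add, mul_add, add_mul,
          Finset.sum_add_distrib]; abel)
    (by intros; simp only [extBracket, origBracket, ghostBracket, map_smul, smul_mul_assoc,
          mul_smul_comm, Finset.smul_sum, smul_add])

theorem origBracket_smul_smul (c : Fin n → Fin n → GenPoly n) (r s : ℂ) (x y : ExtAlg n) :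
    origBracket c (r • x) (s • y) = (r * s) • origBracket c x y := by
  simp only [origBracket, map_smul, smul_mul_assoc, mul_smul_comm, Finset.smul_sum, smul_smul,
    mul_comm s]

theorem ghostBracket_smul_smul (r s : ℂ) (x y : ExtAlg n) :
    ghostBracket (r • x) (s • y) = (r * s) • ghostBracket x y := by
  simp only [ghostBracket, map_smul, smul_mul_assoc, mul_smul_comm, Finset.smul_sum, smul_smul,
    smul_add, mul_comm s]

/-! ### The elements from which the charge is built -/

/-- The even element `N = ∑_{α ≥ 2} η^α P_α`. -/
def ghostPair (m : ℕ) : ExtAlg (m + 1) := ∑ i : Fin m, eta i.succ * P i.succ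

/-- The odd element `S = ∑_{α ≥ 2} G_α η^α`. -/
def partialCharge (m : ℕ) : ExtAlg (m + 1) := ∑ i : Fin m, G i.succ * eta i.succ

/-- The element `W_l = η^1 N^l (G_1 N + S P_1)`, to which `Ω^(l+1)` is proportional. -/
def chargeTerm (m l : ℕ) : ExtAlg (m + 1) :=
  eta 0 * (ghostPair m ^ l * (G 0 * ghostPair m + partialCharge m * P 0))

/-- The element `X_p = G_1 η^1 S N^p`, to which `D^(p)` is proportional. -/
def obstructionTerm (m p : ℕ) : ExtAlg (m + 1) :=
  G 0 * (eta 0 * (partialCharge m * ghostPair m ^ p))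

@[simp] theorem paritySign_ghostPair : paritySign (ghostPair m) = ghostPair m := by
  simp [ghostPair, map_sum, paritySign_mul, eta_eq_odd, P_eq_odd]

@[simp] theorem paritySign_partialCharge : paritySign (partialCharge m) = -partialCharge m := by
  simp [partialCharge, map_sum, paritySign_mul, eta_eq_odd]

theorem paritySign_chargeTerm (l : ℕ) : paritySign (chargeTerm m l) = -chargeTerm m l := by
  simp [chargeTerm, paritySign_mul, paritySign_pow, eta_eq_odd, P_eq_odd]

theorem commute_ghostPair (x : ExtAlg (m + 1)) : Commute (ghostPair m) x := by
  refine Commute.sum_left _ _ _ fun i _ => ?_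
  rw [Commute, SemiconjBy, mul_assoc, P_eq_odd, eta_eq_odd, odd_mul (Sum.inr _), ← mul_assoc,
    odd_mul, paritySign_paritySign, mul_assoc]

theorem ghostPair_pow_mul_comm (l : ℕ) (x : ExtAlg (m + 1)) :
    ghostPair m ^ l * x = x * ghostPair m ^ l := ((commute_ghostPair x).pow_left l).eq

theorem partialCharge_mul (x : ExtAlg (m + 1)) :
    partialCharge m * x = paritySign x * partialCharge m := by
  rw [partialCharge, Finset.sum_mul, Finset.mul_sum]
  refine Finset.sum_congr rfl fun i _ => ?_
  rw [mul_assoc, eta_eq_odd, odd_mul, ← mul_assoc, (commute_G _ _).eq, mul_assoc]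

theorem partialCharge_mul_self : partialCharge m * partialCharge m = 0 := by
  have h := partialCharge_mul (partialCharge m)
  rw [paritySign_partialCharge, ext_neg_mul] at h
  have h2 : (2 : ℂ) • (partialCharge m * partialCharge m) = 0 := by
    rw [two_smul]
    nth_rewrite 1 [h]
    exact neg_add_cancel _
  exact (smul_eq_zero_iff_right two_ne_zero).1 h2

theorem dG_ghostPair (a : Fin (m + 1)) : dG a (ghostPair m) = 0 := by
  simp [ghostPair, map_sum, dG_mul, eta_eq_odd, P_eq_odd]

theorem dG_zero_partialCharge : dG 0 (partialCharge m) = 0 := by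
  simp [partialCharge, map_sum, dG_mul, eta_eq_odd, dG_G, (Fin.succ_ne_zero _).symm]

theorem dG_succ_partialCharge (i : Fin m) : dG i.succ (partialCharge m) = eta i.succ := by
  simp [partialCharge, map_sum, dG_mul, eta_eq_odd, dG_G]

theorem dEta_zero_ghostPair : dEta 0 (ghostPair m) = 0 := by
  simp [dEta, ghostPair, map_sum, dOdd_mul, eta_eq_odd, P_eq_odd, dOdd_odd,
    (Fin.succ_ne_zero _).symm]

theorem dP_zero_ghostPair : dP 0 (ghostPair m) = 0 := by
  simp [dP, ghostPair, map_sum, dOdd_mul, eta_eq_odd, P_eq_odd, dOdd_odd,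
    (Fin.succ_ne_zero _).symm]

theorem dP_succ_ghostPair (i : Fin m) : dP i.succ (ghostPair m) = -eta i.succ := by
  simp [dP, ghostPair, map_sum, dOdd_mul, eta_eq_odd, P_eq_odd, dOdd_odd]

theorem dEta_zero_partialCharge : dEta 0 (partialCharge m) = 0 := by
  simp [dEta, partialCharge, map_sum, dOdd_G_mul, eta_eq_odd, dOdd_odd, (Fin.succ_ne_zero _).symm]

theorem dP_partialCharge (a : Fin (m + 1)) : dP a (partialCharge m) = 0 := by
  simp [dP, partialCharge, map_sum, dOdd_G_mul, eta_eq_odd, dOdd_odd]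

theorem dG_ghostPair_pow_mul (a : Fin (m + 1)) (l : ℕ) (x : ExtAlg (m + 1)) :
    dG a (ghostPair m ^ l * x) = ghostPair m ^ l * dG a x := by
  rw [dG_mul, dG_pow_of_eq_zero (dG_ghostPair a), zero_mul, zero_add]

theorem dOdd_ghostPair_pow (i : Fin (m + 1) ⊕ Fin (m + 1)) (l : ℕ) :
    dOdd i (ghostPair m ^ l) = (l : ℂ) • (dOdd i (ghostPair m) * ghostPair m ^ (l - 1)) :=
  dOdd_pow paritySign_ghostPair (commute_ghostPair _) l

theorem dOdd_ghostPair_pow_mul {i : Fin (m + 1) ⊕ Fin (m + 1)} (h : dOdd i (ghostPair m) = 0)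
    (l : ℕ) (x : ExtAlg (m + 1)) :
    dOdd i (ghostPair m ^ l * x) = ghostPair m ^ l * dOdd i x := by
  rw [dOdd_mul, dOdd_ghostPair_pow, h, zero_mul, smul_zero, zero_mul, zero_add, paritySign_pow,
    paritySign_ghostPair]

/-! ### Derivatives of the terms of the charge -/

theorem dG_zero_chargeTerm (l : ℕ) : dG 0 (chargeTerm m l) = eta 0 * ghostPair m ^ (l + 1) := by
  rw [chargeTerm, eta_eq_odd, dG_odd_mul, dG_ghostPair_pow_mul, map_add, dG_mul, dG_mul, P_eq_odd,
    dG_odd, dG_G, if_pos rfl, dG_ghostPair, dG_zero_partialCharge, pow_succ]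
  simp only [one_mul, mul_zero, zero_mul, add_zero]

theorem dG_succ_chargeTerm (l : ℕ) (i : Fin m) :
    dG i.succ (chargeTerm m l) = eta 0 * (ghostPair m ^ l * (eta i.succ * P 0)) := by
  rw [chargeTerm, eta_eq_odd, dG_odd_mul, dG_ghostPair_pow_mul, map_add, dG_mul, dG_mul, P_eq_odd,
    dG_odd, dG_G, if_neg (Fin.succ_ne_zero i), dG_ghostPair, dG_succ_partialCharge]
  simp only [mul_zero, zero_mul, add_zero, zero_add]

theorem dEta_zero_chargeTerm (l : ℕ) :
    dEta 0 (chargeTerm m l) = ghostPair m ^ l * (G 0 * ghostPair m + partialCharge m * P 0) := by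
  have hN : dOdd (Sum.inl 0) (ghostPair m) = 0 := dEta_zero_ghostPair
  have hS : dOdd (Sum.inl 0) (partialCharge m) = 0 := dEta_zero_partialCharge
  rw [dEta, chargeTerm, eta_eq_odd, dOdd_odd_mul, if_pos rfl, dOdd_ghostPair_pow_mul hN, map_add,
    dOdd_G_mul, hN, dOdd_mul, hS, P_eq_odd, dOdd_odd_of_ne (by simp)]
  simp only [mul_zero, zero_mul, add_zero, sub_zero]

theorem dP_zero_chargeTerm (l : ℕ) :
    dP 0 (chargeTerm m l) = eta 0 * (ghostPair m ^ l * partialCharge m) := by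
  have hN : dOdd (Sum.inr 0) (ghostPair m) = 0 := dP_zero_ghostPair
  have hS : dOdd (Sum.inr 0) (partialCharge m) = 0 := dP_partialCharge 0
  rw [dP, chargeTerm, eta_eq_odd, dOdd_odd_mul, if_neg (by simp), dOdd_ghostPair_pow_mul hN,
    map_add, dOdd_G_mul, hN, dOdd_mul, hS, P_eq_odd, dOdd_odd_self, paritySign_partialCharge]
  simp only [mul_zero, zero_mul, zero_add, zero_sub, ext_mul_neg, neg_neg, mul_one]

/-! ### The brackets of the terms of the charge -/

theorem dG_ghostCharge (a : Fin n) : dG a (∑ b : Fin n, G b * eta b) = eta a := by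
  simp [map_sum, dG_mul, eta_eq_odd, dG_G]

theorem dEta_ghostCharge (a : Fin n) : dEta a (∑ b : Fin n, G b * eta b) = G a := by
  simp [dEta, map_sum, dOdd_G_mul, eta_eq_odd, dOdd_odd]

theorem dP_ghostCharge (a : Fin n) : dP a (∑ b : Fin n, G b * eta b) = 0 := by
  simp [dP, map_sum, dOdd_G_mul, eta_eq_odd, dOdd_odd]

theorem paritySign_ghostCharge :
    paritySign (∑ b : Fin n, G b * eta b) = -∑ b : Fin n, G b * eta b := by
  simp [map_sum, paritySign_mul, eta_eq_odd]

theorem eta_mul_eta (a b : Fin n) : eta a * eta b = -(eta b * eta a) := by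
  rw [eta_eq_odd, odd_mul, eta_eq_odd, paritySign_odd, ext_neg_mul]

theorem eta_zero_mul_eq_zero (x y : ExtAlg (m + 1)) : eta 0 * x * (eta 0 * y) = 0 :=
  odd_mul_mul_odd_mul _ x y

theorem sum_eta_mul_G (x : ExtAlg (m + 1)) :
    ∑ i : Fin m, x * eta i.succ * (G 0 * G i.succ) = G 0 * (x * partialCharge m) := by
  rw [partialCharge, Finset.mul_sum, Finset.mul_sum]
  refine Finset.sum_congr rfl fun i _ => ?_
  rw [(commute_G i.succ (eta i.succ)).eq, ← mul_assoc, ← (commute_G 0 _).eq, mul_assoc, mul_assoc]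

theorem origBracket_ghostCharge_ghostCharge :
    origBracket (selfRep m) (∑ a, G a * eta a) (∑ a, G a * eta a)
      = (2 : ℂ) • obstructionTerm m 0 := by
  rw [origBracket_selfRep]
  simp only [dG_ghostCharge]
  have h : ∀ i : Fin m, (eta 0 * eta i.succ - eta i.succ * eta 0) * (G 0 * G i.succ)
      = (2 : ℂ) • (eta 0 * eta i.succ * (G 0 * G i.succ)) := fun i => by
    rw [eta_mul_eta i.succ 0, sub_neg_eq_add, ← two_smul ℂ, smul_mul_assoc]
  simp only [h]
  rw [← Finset.smul_sum, sum_eta_mul_G, obstructionTerm, pow_zero, mul_one]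

theorem origBracket_chargeTerm_ghostCharge (l : ℕ) :
    origBracket (selfRep m) (chargeTerm m l) (∑ a, G a * eta a) = obstructionTerm m (l + 1) := by
  have h (i : Fin m) : eta 0 * (ghostPair m ^ l * (eta i.succ * P 0)) * eta 0 = 0 := by
    have := eta_zero_mul_eq_zero (m := m) (ghostPair m ^ l * (eta i.succ * P 0)) 1
    rwa [mul_one] at this
  rw [origBracket_selfRep]
  simp only [dG_ghostCharge, dG_zero_chargeTerm, dG_succ_chargeTerm, h, sub_zero]
  rw [sum_eta_mul_G, obstructionTerm, mul_assoc, ((commute_ghostPair _).pow_left _).eq]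

theorem origBracket_ghostCharge_chargeTerm (l : ℕ) :
    origBracket (selfRep m) (∑ a, G a * eta a) (chargeTerm m l) = obstructionTerm m (l + 1) := by
  have h (i : Fin m) : eta 0 * (eta 0 * (ghostPair m ^ l * (eta i.succ * P 0))) = 0 := by
    rw [← mul_assoc, eta_eq_odd, odd_mul_self, zero_mul]
  have h' (i : Fin m) : -(eta i.succ * (eta 0 * ghostPair m ^ (l + 1)))
      = eta 0 * ghostPair m ^ (l + 1) * eta i.succ := by
    rw [← mul_assoc, eta_mul_eta, ext_neg_mul, neg_neg, mul_assoc, mul_assoc,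
      ((commute_ghostPair _).pow_left _).eq]
  rw [origBracket_selfRep]
  simp only [dG_ghostCharge, dG_zero_chargeTerm, dG_succ_chargeTerm, h, zero_sub, h']
  rw [sum_eta_mul_G, obstructionTerm, mul_assoc, ((commute_ghostPair _).pow_left _).eq]

theorem origBracket_chargeTerm_chargeTerm (i j : ℕ) :
    origBracket (selfRep m) (chargeTerm m i) (chargeTerm m j) = 0 := by
  rw [origBracket_selfRep]
  refine Finset.sum_eq_zero fun a _ => ?_
  simp only [dG_zero_chargeTerm, dG_succ_chargeTerm, eta_zero_mul_eq_zero, sub_zero, zero_mul]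

theorem ghostBracket_ghostCharge_ghostCharge :
    ghostBracket (∑ a : Fin n, G a * eta a) (∑ a, G a * eta a) = 0 := by
  simp only [ghostBracket, paritySign_ghostCharge, map_neg, dP_ghostCharge, mul_zero, neg_zero,
    zero_mul, add_zero, Finset.sum_const_zero]

theorem dEta_succ_chargeTerm (l : ℕ) (i : Fin m) :
    ∃ y, dEta i.succ (chargeTerm m l) = eta 0 * y := by
  rw [dEta, chargeTerm, eta_eq_odd, dOdd_odd_mul, if_neg (by simp), zero_sub]
  exact ⟨_, (ext_mul_neg _ _).symm⟩

theorem dP_succ_chargeTerm (l : ℕ) (i : Fin m) :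
    dP i.succ (chargeTerm m l)
      = -(eta 0 * dP i.succ (ghostPair m ^ l * (G 0 * ghostPair m + partialCharge m * P 0))) := by
  rw [dP, chargeTerm, eta_eq_odd, dOdd_odd_mul, if_neg (by simp), zero_sub]

theorem factor_mul_partialCharge :
    (G 0 * ghostPair m + partialCharge m * P 0) * partialCharge m
      = G 0 * (partialCharge m * ghostPair m) := by
  rw [add_mul, mul_assoc (partialCharge m), P_eq_odd, odd_mul, paritySign_partialCharge,
    ext_neg_mul, ext_mul_neg, ← mul_assoc (partialCharge m), partialCharge_mul_self, zero_mul,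
    neg_zero, add_zero, mul_assoc, (commute_ghostPair _).eq]

theorem partialCharge_mul_factor :
    partialCharge m * (G 0 * ghostPair m + partialCharge m * P 0)
      = G 0 * (partialCharge m * ghostPair m) := by
  rw [mul_add, ← mul_assoc (partialCharge m) (partialCharge m), partialCharge_mul_self, zero_mul,
    add_zero, ← mul_assoc, ← (commute_G _ _).eq, mul_assoc]

theorem ghostBracket_chargeTerm_chargeTerm (i j : ℕ) :
    ghostBracket (chargeTerm m i) (chargeTerm m j)
      = (-2 : ℂ) • obstructionTerm m (i + j + 1) := by
  -- the derivatives with respect to `η^α` and `P_α` with `α ≥ 2` retain the factor `η^1`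
  have h (a : Fin m) : dEta a.succ (chargeTerm m i) * dP a.succ (chargeTerm m j)
      + dP a.succ (chargeTerm m i) * dEta a.succ (chargeTerm m j) = 0 := by
    obtain ⟨y, hy⟩ := dEta_succ_chargeTerm i a
    obtain ⟨z, hz⟩ := dEta_succ_chargeTerm j a
    rw [hy, hz, dP_succ_chargeTerm, dP_succ_chargeTerm, ext_mul_neg, ext_neg_mul,
      eta_zero_mul_eq_zero, eta_zero_mul_eq_zero, neg_zero, add_zero]
  have hpar : paritySign (ghostPair m ^ i * (G 0 * ghostPair m + partialCharge m * P 0))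
      = ghostPair m ^ i * (G 0 * ghostPair m + partialCharge m * P 0) := by
    simp [paritySign_mul, paritySign_pow, P_eq_odd]
  have h1 : ghostPair m ^ i * (G 0 * ghostPair m + partialCharge m * P 0)
      * (eta 0 * (ghostPair m ^ j * partialCharge m)) = obstructionTerm m (i + j + 1) := by
    rw [← mul_assoc, ← hpar, eta_eq_odd, ← odd_mul, mul_assoc (odd _),
      ((commute_ghostPair (partialCharge m)).pow_left j).eq, ← mul_assoc (_ * _), mul_assoc (_ ^ i),
      factor_mul_partialCharge, ((commute_ghostPair _).pow_left i).eq, mul_assoc (G 0),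
      mul_assoc (G 0), ← mul_assoc, ← (commute_G _ _).eq, mul_assoc, obstructionTerm,
      mul_assoc (partialCharge m),
      mul_assoc (partialCharge m), ← pow_succ', ← pow_add, eta_eq_odd, Nat.add_right_comm]
  have h2 : eta 0 * (ghostPair m ^ i * partialCharge m)
      * (ghostPair m ^ j * (G 0 * ghostPair m + partialCharge m * P 0))
      = obstructionTerm m (i + j + 1) := by
    rw [← mul_assoc, mul_assoc (eta 0), mul_assoc (_ ^ i), ← ((commute_ghostPair _).pow_left j).eq,
      mul_assoc (eta 0), ← mul_assoc (_ ^ i), ← pow_add, mul_assoc (_ ^ _),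
      partialCharge_mul_factor,
      ((commute_ghostPair _).pow_left _).eq, mul_assoc (G 0), ← mul_assoc, ← (commute_G _ _).eq,
      mul_assoc (G 0), mul_assoc (partialCharge m), ← pow_succ', obstructionTerm]
  rw [ghostBracket, Fin.sum_univ_succ]
  simp only [paritySign_chargeTerm, map_neg, ext_neg_mul, ← neg_add, h, neg_zero,
    Finset.sum_const_zero, add_zero]
  rw [dEta_zero_chargeTerm, dEta_zero_chargeTerm, dP_zero_chargeTerm, dP_zero_chargeTerm, h1, h2,
    ← two_smul ℂ]
  exact (neg_smul _ _).symm

/-- The Koszul differential `∑ G_a ∂/∂P_a`; up to sign, it is the ghost bracket with `Ω^(0)`. -/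
def koszul {n : ℕ} : ExtAlg n →ₗ[ℂ] ExtAlg n :=
  ∑ a, LinearMap.mulLeft ℂ (G a) ∘ₗ dP a

theorem koszul_apply (x : ExtAlg n) : koszul x = ∑ a, G a * dP a x := by
  simp [koszul]

theorem koszul_mul (x y : ExtAlg n) : koszul (x * y) = koszul x * y + paritySign x * koszul y := by
  simp only [koszul_apply, dP, dOdd_mul, mul_add, Finset.sum_add_distrib, Finset.sum_mul,
    Finset.mul_sum]
  congr 1
  · exact Finset.sum_congr rfl fun a _ => (mul_assoc _ _ _).symm
  · refine Finset.sum_congr rfl fun a _ => ?_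
    rw [← mul_assoc, (commute_G _ _).eq, mul_assoc]

theorem koszul_eta (a : Fin n) : koszul (eta a) = 0 := by
  simp [koszul_apply, dP, eta_eq_odd, dOdd_odd]

theorem koszul_P (a : Fin n) : koszul (P a) = G a := by
  simp [koszul_apply, dP, P_eq_odd, dOdd_odd]

theorem koszul_G (a : Fin n) : koszul (G a) = 0 := by
  simp [koszul_apply, dP]

theorem koszul_ghostPair : koszul (ghostPair m) = -partialCharge m := by
  rw [ghostPair, map_sum, partialCharge, ← Finset.sum_neg_distrib]
  refine Finset.sum_congr rfl fun i _ => ?_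
  rw [koszul_mul, koszul_eta, koszul_P, zero_mul, zero_add, eta_eq_odd, paritySign_odd, ext_neg_mul,
    (commute_G _ _).eq]

theorem koszul_partialCharge : koszul (partialCharge m) = 0 := by
  simp [partialCharge, map_sum, koszul_mul, koszul_eta, koszul_G]

theorem koszul_ghostPair_pow_succ (l : ℕ) :
    koszul (ghostPair m ^ (l + 1)) = -((l : ℂ) + 1) • (partialCharge m * ghostPair m ^ l) := by
  induction l with
  | zero =>
    rw [zero_add, pow_one, koszul_ghostPair, pow_zero, mul_one, Nat.cast_zero]
    module
  | succ l ih =>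
    rw [pow_succ', koszul_mul, koszul_ghostPair, ih, paritySign_ghostPair, mul_smul_comm,
      ← mul_assoc, (commute_ghostPair _).eq, mul_assoc, ← pow_succ', ext_neg_mul, Nat.cast_succ]
    module

theorem koszul_chargeTerm (l : ℕ) :
    koszul (chargeTerm m l) = ((l : ℂ) + 2) • obstructionTerm m l := by
  have hZ : koszul (G 0 * ghostPair m + partialCharge m * P 0)
      = -(2 : ℂ) • (G 0 * partialCharge m) := by
    rw [map_add, koszul_mul, koszul_mul, koszul_G, koszul_ghostPair, koszul_P, koszul_partialCharge,
      paritySign_G, paritySign_partialCharge, ext_mul_neg, ext_neg_mul, ← (commute_G 0 _).eq,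
      zero_mul, zero_mul]
    module
  have hX : eta 0 * (partialCharge m * ghostPair m ^ l * G 0) = obstructionTerm m l := by
    rw [← (commute_G 0 _).eq, ← mul_assoc, ← (commute_G 0 _).eq, mul_assoc, obstructionTerm]
  have hN : ghostPair m ^ l * (G 0 * partialCharge m)
      = partialCharge m * ghostPair m ^ l * G 0 := by
    rw [((commute_ghostPair _).pow_left l).eq, mul_assoc, (commute_G 0 _).eq]
  rw [chargeTerm, koszul_mul, koszul_eta, zero_mul, zero_add, eta_eq_odd, paritySign_odd,
    ext_neg_mul, ← eta_eq_odd, koszul_mul, paritySign_pow, paritySign_ghostPair, hZ, mul_smul_comm,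
    hN, mul_add, mul_smul_comm, hX]
  cases l with
  | zero =>
    rw [pow_zero, koszul_apply]
    simp [dP]
    module
  | succ l =>
    rw [koszul_ghostPair_pow_succ, smul_mul_assoc, ← ghostPair_pow_mul_comm, mul_assoc,
      partialCharge_mul_factor, ← mul_assoc (G 0), ← mul_assoc, ghostPair_pow_mul_comm, mul_assoc,
      ← pow_succ, mul_assoc, (commute_G 0 _).eq, mul_smul_comm, hX, Nat.cast_succ]
    module

theorem ghostBracket_ghostCharge_left (x : ExtAlg n) :
    ghostBracket (∑ a, G a * eta a) x = -koszul x := by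
  simp only [ghostBracket, paritySign_ghostCharge, map_neg, dP_ghostCharge, dEta_ghostCharge,
    neg_zero, zero_mul, add_zero, koszul_apply, ext_neg_mul, Finset.sum_neg_distrib]

theorem ghostBracket_ghostCharge_right {x : ExtAlg n} (hx : paritySign x = -x) :
    ghostBracket x (∑ a, G a * eta a) = -koszul x := by
  rw [ghostBracket, koszul_apply, ← Finset.sum_neg_distrib]
  refine Finset.sum_congr rfl fun a _ => ?_
  rw [hx, dP_ghostCharge, dEta_ghostCharge, mul_zero, zero_add, map_neg, ext_neg_mul,
    (commute_G _ _).eq]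

theorem homotopy_obstructionTerm (p : ℕ) : homotopy (obstructionTerm m p) = -chargeTerm m p := by
  have h0 : dG 0 (obstructionTerm m p) = eta 0 * (partialCharge m * ghostPair m ^ p) := by
    rw [obstructionTerm, dG_mul, dG_G, if_pos rfl, eta_eq_odd, dG_odd_mul, dG_mul,
      dG_zero_partialCharge, dG_pow_of_eq_zero (dG_ghostPair 0)]
    simp only [one_mul, zero_mul, mul_zero, add_zero]
  have h1 (i : Fin m) : dG i.succ (obstructionTerm m p)
      = G 0 * (eta 0 * (eta i.succ * ghostPair m ^ p)) := by
    rw [obstructionTerm, dG_mul, dG_G, if_neg (Fin.succ_ne_zero i), eta_eq_odd, dG_odd_mul, dG_mul,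
      dG_succ_partialCharge, dG_pow_of_eq_zero (dG_ghostPair _)]
    simp only [zero_mul, mul_zero, add_zero, zero_add]
  have hP (a : Fin (m + 1)) {x y : ExtAlg (m + 1)} (hx : paritySign x = -x)
      (hy : paritySign y = -y) :
      P a * (x * y * ghostPair m ^ p) = x * (ghostPair m ^ p * (y * P a)) := by
    rw [P_eq_odd, odd_mul, paritySign_mul, paritySign_mul, hx, hy, paritySign_pow,
      paritySign_ghostPair, ext_neg_mul, ext_mul_neg, neg_neg, mul_assoc, mul_assoc,
      ghostPair_pow_mul_comm, ghostPair_pow_mul_comm p (y * _), mul_assoc]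
  have he (a : Fin (m + 1)) : paritySign (eta a) = -eta a := paritySign_odd _
  rw [homotopy, Fin.sum_univ_succ]
  simp only [h0, h1]
  rw [← mul_assoc (eta 0), hP 0 (he 0) paritySign_partialCharge, chargeTerm, add_comm (G 0 * _),
    mul_add, mul_add]
  congr 2
  have (i : Fin m) : P i.succ * (G 0 * (eta 0 * (eta i.succ * ghostPair m ^ p)))
      = eta 0 * (ghostPair m ^ p * (G 0 * (eta i.succ * P i.succ))) := by
    rw [← mul_assoc, ← (commute_G 0 _).eq, mul_assoc, ← mul_assoc (eta 0), hP _ (he _) (he _),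
      (commute_G 0 _).eq, mul_assoc, mul_assoc, (commute_G 0 _).eq]
  simp only [this, ← Finset.mul_sum]
  rw [ghostPair]

/-! ### The sums over multi-indices -/

/-- Each `P_α` is moved next to its `η^α`, which produces a sign and a power of
`N = ∑ η^α P_α`; the sign `s` is the one of moving a `P_α` across `y`. -/
theorem sum_prod_eta_mul_prod_P (k : ℕ) (y : ExtAlg (m + 1)) (s : ℂ)
    (h : ∀ i : Fin m, y * P i.succ = s • (P i.succ * y)) :
    ∑ α : Fin k → Fin m, (List.ofFn fun i => eta (α i).succ).prod * y
        * (List.ofFn fun i => P (α i).succ).prod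
      = ((-1) ^ (∑ i ∈ Finset.range k, i) * s ^ k) • (ghostPair m ^ k * y) := by
  induction k generalizing y s with
  | zero => simp
  | succ k ih =>
    have hy (a i : Fin m) : y * P a.succ * P i.succ = (-s) • (P i.succ * (y * P a.succ)) := by
      rw [mul_assoc, P_eq_odd a.succ, odd_mul, P_eq_odd, paritySign_odd, ext_neg_mul, ext_mul_neg,
        ← mul_assoc, ← P_eq_odd i.succ, h, smul_mul_assoc, mul_assoc]
      exact (neg_smul _ _).symm
    rw [← (Fin.consEquiv fun _ => Fin m).sum_comp, Fintype.sum_prod_type]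
    simp only [Fin.consEquiv, Equiv.coe_fn_mk, List.ofFn_succ, Fin.cons_zero, Fin.cons_succ,
      List.prod_cons]
    have key (a : Fin m) : ∑ α : Fin k → Fin m,
        eta a.succ * (List.ofFn fun i => eta (α i).succ).prod * y
          * (P a.succ * (List.ofFn fun i => P (α i).succ).prod)
        = ((-1) ^ (∑ i ∈ Finset.range (k + 1), i) * s ^ (k + 1)) •
          (ghostPair m ^ k * (eta a.succ * P a.succ) * y) := by
      have := congrArg (eta a.succ * ·) (ih (y * P a.succ) (-s) (hy a))
      simp only [Finset.mul_sum, mul_smul_comm] at this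
      simp only [mul_assoc] at this ⊢
      rw [this, h, mul_smul_comm, mul_smul_comm, smul_smul, ← mul_assoc, ← ghostPair_pow_mul_comm,
        mul_assoc, mul_assoc, Finset.sum_range_succ, pow_add, neg_pow s]
      congr 1
      ring
    simp only [key]
    rw [← Finset.smul_sum, ← Finset.sum_mul, ← Finset.mul_sum, ← ghostPair, ← pow_succ]

theorem T1_eq (k : ℕ) :
    T1 m k = ((-1) ^ (∑ i ∈ Finset.range k, i) * (-1) ^ k : ℂ) •
      (eta 0 * (ghostPair m ^ k * G 0)) := by
  have h (i : Fin m) : eta 0 * P i.succ = (-1 : ℂ) • (P i.succ * eta 0) := by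
    rw [eta_eq_odd, odd_mul, P_eq_odd, paritySign_odd, ext_neg_mul]
    exact (neg_one_smul _ _).symm
  have := congrArg (G 0 * ·) (sum_prod_eta_mul_prod_P k (eta 0) (-1) h)
  simp only [Finset.mul_sum, mul_smul_comm] at this
  rw [ghostPair_pow_mul_comm, (commute_G 0 _).eq, mul_assoc] at this
  rw [T1, ← this]
  simp only [mul_assoc]

theorem T2_eq (l : ℕ) :
    T2 m l = -((-1) ^ (∑ i ∈ Finset.range l, i) * (-1) ^ l : ℂ) •
      (eta 0 * (ghostPair m ^ l * (partialCharge m * P 0))) := by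
  have h (b i : Fin m) : G b.succ * eta b.succ * (eta 0 * P 0) * P i.succ
      = (-1 : ℂ) • (P i.succ * (G b.succ * eta b.succ * (eta 0 * P 0))) := by
    rw [P_eq_odd i.succ, odd_mul]
    simp only [paritySign_mul, paritySign_G, eta_eq_odd, P_eq_odd, paritySign_odd, ext_mul_neg,
      ext_neg_mul, neg_neg]
    module
  have key (b : Fin m) : ∑ α : Fin l → Fin m,
      G b.succ * ((List.ofFn fun i => eta (α i).succ).prod * eta b.succ) * eta 0
          * P 0 * (List.ofFn fun i => P (α i).succ).prod
      = ((-1) ^ (∑ i ∈ Finset.range l, i) * (-1) ^ l : ℂ) •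
        (ghostPair m ^ l * (G b.succ * eta b.succ * (eta 0 * P 0))) := by
    rw [← sum_prod_eta_mul_prod_P l _ (-1) (h b)]
    refine Finset.sum_congr rfl fun α _ => ?_
    rw [← mul_assoc, (commute_G b.succ _).eq]
    simp only [mul_assoc]
  rw [T2, ← (Fin.snocEquiv fun _ => Fin m).sum_comp, Fintype.sum_prod_type]
  simp only [Fin.snocEquiv, Equiv.coe_fn_mk, List.ofFn_succ', Fin.snoc_castSucc, Fin.snoc_last,
    List.concat_eq_append, List.prod_append, List.prod_singleton]
  simp only [key]
  rw [← Finset.smul_sum, ← Finset.mul_sum, ← Finset.sum_mul, ← partialCharge,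
    ← mul_assoc (partialCharge m), partialCharge_mul, eta_eq_odd, paritySign_odd, ext_neg_mul,
    ext_neg_mul, ext_mul_neg, ghostPair_pow_mul_comm, ghostPair_pow_mul_comm, mul_assoc, mul_assoc,
    mul_assoc]
  rw [smul_neg]
  exact (neg_smul _ _).symm

theorem T1_add_T2 (l : ℕ) :
    T1 m (l + 1) + (-1 : ℂ) ^ (l + 1 + 1) • T2 m l
      = ((-1) ^ (∑ i ∈ Finset.range (l + 2), i) : ℂ) • chargeTerm m l := by
  rw [T1_eq, T2_eq, chargeTerm, mul_add, mul_add, smul_add, smul_smul, pow_succ (ghostPair m),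
    mul_assoc (_ ^ l), ← (commute_G 0 _).eq]
  congr 2
  · rw [Finset.sum_range_succ _ (l + 1), ← pow_add]
  · rw [Finset.sum_range_succ _ (l + 1), Finset.sum_range_succ, pow_add, pow_add]
    ring

theorem prod_eta_eq_zero {k : ℕ} {α : Fin k → Fin n} (h : ¬ Function.Injective α) :
    (List.ofFn fun i => eta (α i)).prod = 0 := by
  have : (List.ofFn fun i => eta (α i)).prod
      = Algebra.TensorProduct.includeRight (R := ℂ) (A := GenPoly n)
          (ExteriorAlgebra.ιMulti ℂ k fun i => Pi.single (Sum.inl (α i)) (1 : ℂ)) := by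
    rw [ExteriorAlgebra.ιMulti_apply, map_list_prod, List.map_ofFn]
    rfl
  rw [this, AlternatingMap.map_eq_zero_of_not_injective, map_zero]
  exact fun hi => h fun i j hij => hi (by simp only [hij])

theorem ghostPair_pow_eq_zero : ghostPair m ^ (m + 1) = 0 := by
  have := sum_prod_eta_mul_prod_P (m + 1) (1 : ExtAlg (m + 1)) 1 (by simp)
  rw [Finset.sum_eq_zero, mul_one, one_pow, mul_one] at this
  · exact (smul_eq_zero_iff_right (pow_ne_zero _ (by norm_num))).1 this.symm
  · intro α _
    rw [prod_eta_eq_zero (α := fun i => (α i).succ), zero_mul, zero_mul]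
    intro hα
    have := Fintype.card_le_of_injective α fun i j hij => hα (congrArg Fin.succ hij)
    simp at this

/-- The Koszul differential of `N^(m+1) = 0` is a nonzero multiple of `S N^m`. -/
theorem partialCharge_mul_pow_eq_zero {p : ℕ} (hp : m ≤ p) :
    partialCharge m * ghostPair m ^ p = 0 := by
  have h := koszul_ghostPair_pow_succ (m := m) m
  rw [ghostPair_pow_eq_zero, map_zero] at h
  have h0 : partialCharge m * ghostPair m ^ m = 0 :=
    (smul_eq_zero_iff_right (neg_ne_zero.2 (Nat.cast_add_one_ne_zero m))).1 h.symm
  rw [← Nat.add_sub_cancel' hp, pow_add, ← mul_assoc, h0, zero_mul]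

theorem obstructionTerm_eq_zero {p : ℕ} (hp : m ≤ p) : obstructionTerm m p = 0 := by
  rw [obstructionTerm, partialCharge_mul_pow_eq_zero hp, mul_zero, mul_zero]

theorem chargeTerm_eq_zero {l : ℕ} (hl : m ≤ l) : chargeTerm m l = 0 := by
  rw [← neg_eq_zero, ← homotopy_obstructionTerm, obstructionTerm_eq_zero hl]
  simp [homotopy]

/-! ### Bihomogeneous elements -/

/-- The elements that are homogeneous of degree `g` in the `G_a` and of degree `d` in the `P_a`. -/
def bihomogeneous (n g d : ℕ) : Submodule ℂ (ExtAlg n) :=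
  Submodule.span ℂ {x | ∃ (f : GenPoly n) (e : GhostAlg n), f.IsHomogeneous g ∧
    momentumScale n e = Polynomial.C e * Polynomial.X ^ d ∧ x = f ⊗ₜ[ℂ] e}

theorem mul_mem_bihomogeneous {g d g' d' : ℕ} {x y : ExtAlg n} (hx : x ∈ bihomogeneous n g d)
    (hy : y ∈ bihomogeneous n g' d') : x * y ∈ bihomogeneous n (g + g') (d + d') := by
  have h := Submodule.mul_mem_mul hx hy
  rw [bihomogeneous, bihomogeneous, Submodule.span_mul_span] at h
  refine Submodule.span_mono ?_ h
  rintro _ ⟨_, ⟨f, e, hf, he, rfl⟩, _, ⟨f', e', hf', he', rfl⟩, rfl⟩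
  refine ⟨f * f', e * e', hf.mul hf', ?_, Algebra.TensorProduct.tmul_mul_tmul _ _ _ _⟩
  rw [map_mul, he, he', mul_assoc, ← mul_assoc (_ ^ d), (Polynomial.commute_X_pow _ d).eq,
    Polynomial.C_mul, pow_add]
  simp only [mul_assoc]

theorem pow_mem_bihomogeneous {g d : ℕ} {x : ExtAlg n} (hx : x ∈ bihomogeneous n g d) (k : ℕ) :
    x ^ k ∈ bihomogeneous n (k * g) (k * d) := by
  induction k with
  | zero =>
    refine Submodule.subset_span ⟨1, 1, ?_, ?_, ?_⟩
    · rw [zero_mul]; exact MvPolynomial.isHomogeneous_one _ _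
    · simp
    · rw [pow_zero, Algebra.TensorProduct.one_def]
  | succ k ih =>
    rw [pow_succ, Nat.succ_mul, Nat.succ_mul]
    exact mul_mem_bihomogeneous ih hx

theorem G_mem_bihomogeneous (a : Fin n) : G a ∈ bihomogeneous n 1 0 :=
  Submodule.subset_span ⟨_, 1, MvPolynomial.isHomogeneous_X _ a, by simp, rfl⟩

theorem eta_mem_bihomogeneous (a : Fin n) : eta a ∈ bihomogeneous n 0 0 := by
  refine Submodule.subset_span ⟨1, _, MvPolynomial.isHomogeneous_one _ _, ?_, rfl⟩
  rw [momentumScale, ExteriorAlgebra.lift_ι_apply]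
  have h1 : (Sum.elim (fun b => (Pi.single (Sum.inl a) 1 : Fin n ⊕ Fin n → ℂ) (Sum.inl b))
      (fun _ => 0) : Fin n ⊕ Fin n → ℂ) = Pi.single (Sum.inl a) 1 := by
    ext (i | i) <;> simp [Pi.single_apply]
  have h2 : (Sum.elim (fun _ => 0)
      (fun b => (Pi.single (Sum.inl a) 1 : Fin n ⊕ Fin n → ℂ) (Sum.inr b)) : Fin n ⊕ Fin n → ℂ)
      = 0 := by
    ext (i | i) <;> simp
  simp only [momentumScaleLin, LinearMap.coe_mk, AddHom.coe_mk, h1, h2]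
  simp

theorem P_mem_bihomogeneous (a : Fin n) : P a ∈ bihomogeneous n 0 1 := by
  refine Submodule.subset_span ⟨1, _, MvPolynomial.isHomogeneous_one _ _, ?_, rfl⟩
  rw [momentumScale, ExteriorAlgebra.lift_ι_apply]
  have h1 : (Sum.elim (fun b => (Pi.single (Sum.inr a) 1 : Fin n ⊕ Fin n → ℂ) (Sum.inl b))
      (fun _ => 0) : Fin n ⊕ Fin n → ℂ) = 0 := by
    ext (i | i) <;> simp
  have h2 : (Sum.elim (fun _ => 0)
      (fun b => (Pi.single (Sum.inr a) 1 : Fin n ⊕ Fin n → ℂ) (Sum.inr b)) : Fin n ⊕ Fin n → ℂ)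
      = Pi.single (Sum.inr a) 1 := by
    ext (i | i) <;> simp [Pi.single_apply]
  simp only [momentumScaleLin, LinearMap.coe_mk, AddHom.coe_mk, h1, h2]
  simp

theorem ghostPair_mem_bihomogeneous : ghostPair m ∈ bihomogeneous (m + 1) 0 1 := by
  rw [ghostPair]
  refine Submodule.sum_mem _ fun i _ => ?_
  simpa only [zero_add] using
    mul_mem_bihomogeneous (eta_mem_bihomogeneous i.succ) (P_mem_bihomogeneous i.succ)

theorem ghostPair_pow_mem_bihomogeneous (l : ℕ) :
    ghostPair m ^ l ∈ bihomogeneous (m + 1) 0 l := by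
  simpa using pow_mem_bihomogeneous ghostPair_mem_bihomogeneous l

theorem G_mul_eta_mem_bihomogeneous (a : Fin n) : G a * eta a ∈ bihomogeneous n 1 0 := by
  simpa only [add_zero] using
    mul_mem_bihomogeneous (G_mem_bihomogeneous a) (eta_mem_bihomogeneous a)

theorem ghostCharge_mem_bihomogeneous : ∑ a : Fin n, G a * eta a ∈ bihomogeneous n 1 0 :=
  Submodule.sum_mem _ fun a _ => G_mul_eta_mem_bihomogeneous a

theorem partialCharge_mem_bihomogeneous : partialCharge m ∈ bihomogeneous (m + 1) 1 0 := by
  rw [partialCharge]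
  exact Submodule.sum_mem _ fun i _ => G_mul_eta_mem_bihomogeneous i.succ

theorem chargeTerm_mem_bihomogeneous (l : ℕ) :
    chargeTerm m l ∈ bihomogeneous (m + 1) 1 (l + 1) := by
  have h1 := mul_mem_bihomogeneous (G_mem_bihomogeneous 0) (ghostPair_mem_bihomogeneous (m := m))
  have h2 := mul_mem_bihomogeneous (partialCharge_mem_bihomogeneous (m := m))
    (P_mem_bihomogeneous 0)
  simp only [zero_add, add_zero] at h1 h2
  have h := mul_mem_bihomogeneous (eta_mem_bihomogeneous 0)
    (mul_mem_bihomogeneous (ghostPair_pow_mem_bihomogeneous l) (Submodule.add_mem _ h1 h2))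
  rwa [zero_add, zero_add, zero_add, ← chargeTerm] at h

theorem obstructionTerm_mem_bihomogeneous (p : ℕ) :
    obstructionTerm m p ∈ bihomogeneous (m + 1) 2 p := by
  have h := mul_mem_bihomogeneous (G_mem_bihomogeneous 0) (mul_mem_bihomogeneous
    (eta_mem_bihomogeneous 0) (mul_mem_bihomogeneous partialCharge_mem_bihomogeneous
      (ghostPair_pow_mem_bihomogeneous (m := m) p)))
  simp only [zero_add, add_zero] at h
  rwa [← obstructionTerm] at h

theorem ghostMomentumPart_of_scale {d : ℕ} {e : GhostAlg n}
    (he : momentumScale n e = Polynomial.C e * Polynomial.X ^ d) (j : ℕ) :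
    ghostMomentumPart j e = if j = d then e else 0 := by
  change (momentumScale n e).coeff j = _
  rw [he, Polynomial.coeff_C_mul_X_pow]

theorem momentumPart_of_mem {g d : ℕ} {x : ExtAlg n} (hx : x ∈ bihomogeneous n g d) (j : ℕ) :
    momentumPart j x = if j = d then x else 0 := by
  induction hx using Submodule.span_induction with
  | zero => simp
  | add x y _ _ hx hy => rw [map_add, hx, hy]; split_ifs <;> simp
  | smul r x _ hx => rw [map_smul, hx]; split_ifs <;> simp
  | mem x hx =>
    obtain ⟨f, e, _, he, rfl⟩ := hx
    rw [momentumPart, TensorProduct.map_tmul, ghostMomentumPart_of_scale he]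
    split_ifs <;> simp

theorem degreePart_of_mem {g d : ℕ} {x : ExtAlg n} (hx : x ∈ bihomogeneous n g d) (j : ℕ) :
    degreePart j x = if j = g + d then x else 0 := by
  induction hx using Submodule.span_induction with
  | zero => simp
  | add x y _ _ hx hy => rw [map_add, hx, hy]; split_ifs <;> simp
  | smul r x _ hx => rw [map_smul, hx]; split_ifs <;> simp
  | mem x hx =>
    obtain ⟨f, e, hf, he, rfl⟩ := hx
    simp only [degreePart, LinearMap.sum_apply, TensorProduct.map_tmul,
      ghostMomentumPart_of_scale he, MvPolynomial.homogeneousComponent_of_mem hf]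
    split_ifs with h
    · rw [Finset.sum_eq_single (g, d)]
      · simp
      · rintro ⟨i, j⟩ _ hij
        by_cases h1 : i = g
        · have h2 : j ≠ d := fun h2 => hij (by rw [h1, h2])
          simp [h2]
        · simp [h1]
      · intro h'
        exact absurd (Finset.HasAntidiagonal.mem_antidiagonal.2 h.symm) h'
    · refine Finset.sum_eq_zero fun ij hij => ?_
      have := Finset.HasAntidiagonal.mem_antidiagonal.1 hij
      by_cases h1 : ij.1 = g
      · have h2 : ij.2 ≠ d := by omega
        simp [h2]
      · simp [h1]

theorem weightedHomotopy_of_mem {g d : ℕ} {x : ExtAlg n} (hx : x ∈ bihomogeneous n g d) :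
    weightedHomotopy x = (((g + d : ℕ) : ℂ)⁻¹) • homotopy x := by
  rw [weightedHomotopy, finsum_eq_single _ (g + d), degreePart_of_mem hx, if_pos rfl]
  intro j hj
  rw [degreePart_of_mem hx, if_neg hj]
  simp [homotopy]

theorem homotopy_smul (r : ℂ) (x : ExtAlg n) : homotopy (r • x) = r • homotopy x := by
  simp only [homotopy, map_smul, mul_smul_comm, ← Finset.smul_sum, smul_neg]

/-! ### The coefficients -/

/-- The coefficients `α_k`, with the value `α_0 = 1` that belongs to `Ω^(0)`. -/
def alphaCoeff : ℕ → ℝ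
  | 0 => 1
  | 1 => -1 / 2
  | 2 => -1 / 12
  | 3 => 0
  | k + 4 => -(1 / ((k : ℝ) + 5)) *
      ∑ j : Fin (k + 1), alphaCoeff ((j : ℕ) + 2) * alphaCoeff (k + 2 - (j : ℕ))
  decreasing_by all_goals omega

theorem alphaCoeff_zero : alphaCoeff 0 = 1 := by rw [alphaCoeff]

theorem alphaCoeff_one : alphaCoeff 1 = -1 / 2 := by rw [alphaCoeff]

theorem alphaCoeff_two : alphaCoeff 2 = -1 / 12 := by rw [alphaCoeff]

theorem alphaCoeff_three : alphaCoeff 3 = 0 := by rw [alphaCoeff]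

theorem alphaCoeff_add_four (k : ℕ) :
    alphaCoeff (k + 4) = -(1 / ((k : ℝ) + 5)) *
      ∑ j ∈ Finset.range (k + 1), alphaCoeff (j + 2) * alphaCoeff (k + 2 - j) := by
  rw [alphaCoeff, Finset.sum_range]

theorem alphaCoeff_of_three_lt {k : ℕ} (hk : 3 < k) :
    alphaCoeff k = -(1 / ((k : ℝ) + 1)) *
      ∑ l ∈ Finset.Icc 1 (k - 3), alphaCoeff (l + 1) * alphaCoeff (k - l - 1) := by
  obtain ⟨k, rfl⟩ := Nat.exists_eq_add_of_lt hk
  rw [show 3 + k + 1 = k + 4 by omega, alphaCoeff_add_four, Nat.cast_add, add_assoc]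
  congr 1
  · norm_num
  · have h := Finset.sum_Ico_add' (fun l => alphaCoeff (l + 1) * alphaCoeff (k + 4 - l - 1))
      0 (k + 1) 1
    rw [zero_add, Finset.Ico_add_one_right_eq_Icc 1] at h
    rw [show k + 4 - 3 = k + 1 by omega, ← h, Finset.range_eq_Ico]
    refine Finset.sum_congr rfl fun j _ => ?_
    rw [show k + 4 - (j + 1) - 1 = k + 2 - j by omega]

theorem alphaCoeff_odd : ∀ k : ℕ, Odd k → 1 < k → alphaCoeff k = 0
  | 0, h, _ => by simp at h
  | 1, _, h => by simp at h
  | 2, h, _ => by revert h; decide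
  | 3, _, _ => alphaCoeff_three
  | k + 4, h, _ => by
    rw [alphaCoeff_add_four, Finset.sum_eq_zero, mul_zero]
    intro j hj
    rw [Finset.mem_range] at hj
    obtain ⟨c, hc⟩ := h
    -- the two indices add up to an odd number, hence one of them is odd
    have hj' : j ≤ k := by omega
    rcases Nat.even_or_odd' j with ⟨i, hi | hi⟩
    · rw [alphaCoeff_odd (k + 2 - j) ⟨c - i - 1, by omega⟩ (by omega), mul_zero]
    · rw [alphaCoeff_odd (j + 2) ⟨i + 1, by omega⟩ (by omega), zero_mul]
  decreasing_by
    all_goals omega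

theorem alphaCoeff_even : ∀ k : ℕ, Even k → 0 < k → alphaCoeff k < 0
  | 0, _, h => by simp at h
  | 1, h, _ => by simp at h
  | 2, _, _ => by rw [alphaCoeff_two]; norm_num
  | 3, h, _ => by revert h; decide
  | k + 4, h, _ => by
    obtain ⟨c, hc⟩ := h
    have hpos : ∀ j ∈ Finset.range (k + 1),
        (Even j → 0 < alphaCoeff (j + 2) * alphaCoeff (k + 2 - j)) ∧
          0 ≤ alphaCoeff (j + 2) * alphaCoeff (k + 2 - j) := by
      intro j hj
      rw [Finset.mem_range] at hj
      have he : Even j → 0 < alphaCoeff (j + 2) * alphaCoeff (k + 2 - j) := by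
        have hj' : j ≤ k := by omega
        rintro ⟨i, hi⟩
        exact mul_pos_of_neg_of_neg (alphaCoeff_even (j + 2) ⟨i + 1, by omega⟩ (by omega))
          (alphaCoeff_even (k + 2 - j) ⟨c - i - 1, by omega⟩ (by omega))
      refine ⟨he, ?_⟩
      rcases Nat.even_or_odd j with hj' | ⟨i, hi⟩
      · exact (he hj').le
      · rw [alphaCoeff_odd (j + 2) ⟨i + 1, by omega⟩ (by omega), zero_mul]
    rw [alphaCoeff_add_four]
    refine mul_neg_of_neg_of_pos (neg_lt_zero.2 (by positivity)) ?_
    exact Finset.sum_pos' (fun j hj => (hpos j hj).2) ⟨0, by simp, (hpos 0 (by simp)).1 (by simp)⟩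
  decreasing_by all_goals omega

/-- The sign `(-1)^(k(k+1)/2)`, which relates `T₁` and `T₂` to powers of `N = ∑ η^α P_α`. -/
def orderSign (k : ℕ) : ℝ := (-1) ^ ∑ i ∈ Finset.range (k + 1), i

theorem orderSign_mul_self (k : ℕ) : orderSign k * orderSign k = 1 := by
  rw [orderSign, ← pow_add, ← two_mul, pow_mul]
  simp

theorem orderSign_add (i j : ℕ) :
    orderSign (i + j) = orderSign i * orderSign j * (-1) ^ (i * j) := by
  have h (k : ℕ) : orderSign (k + 1) = orderSign k * (-1) ^ (k + 1) := by
    rw [orderSign, Finset.sum_range_succ, pow_add, orderSign]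
  induction j with
  | zero => simp [orderSign]
  | succ j ih =>
    rw [← add_assoc, h, ih, h]
    ring

/-- The coefficient of `W_(k-1)` in `Ω^(k)`, which is the `k`-th Taylor coefficient of
`x / (1 - e^(-x))`. -/
def betaCoeff (k : ℕ) : ℝ := orderSign k * alphaCoeff k

theorem betaCoeff_zero : betaCoeff 0 = 1 := by
  simp [betaCoeff, orderSign, alphaCoeff_zero]

theorem betaCoeff_one : betaCoeff 1 = 1 / 2 := by
  norm_num [betaCoeff, orderSign, alphaCoeff_one, Finset.sum_range_succ]

theorem betaCoeff_two : betaCoeff 2 = 1 / 12 := by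
  norm_num [betaCoeff, orderSign, alphaCoeff_two, Finset.sum_range_succ]

theorem betaCoeff_three : betaCoeff 3 = 0 := by
  simp [betaCoeff, alphaCoeff_three]

theorem betaCoeff_add_four (k : ℕ) :
    ((k : ℝ) + 5) * betaCoeff (k + 4)
      = -∑ j ∈ Finset.range (k + 1), betaCoeff (j + 2) * betaCoeff (k + 2 - j) := by
  have hk : (k : ℝ) + 5 ≠ 0 := by positivity
  have h : ∀ j ∈ Finset.range (k + 1), betaCoeff (j + 2) * betaCoeff (k + 2 - j)
      = orderSign (k + 4) * (alphaCoeff (j + 2) * alphaCoeff (k + 2 - j)) := by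
    intro j hj
    rw [Finset.mem_range] at hj
    rw [show k + 4 = (j + 2) + (k + 2 - j) by omega, orderSign_add]
    rcases Nat.even_or_odd j with ⟨i, hi⟩ | ⟨i, hi⟩
    · rw [Even.neg_one_pow (Even.mul_right ⟨i + 1, by omega⟩ _), betaCoeff, betaCoeff]
      ring
    · rw [betaCoeff, alphaCoeff_odd (j + 2) ⟨i + 1, by omega⟩ (by omega)]
      ring
  rw [Finset.sum_congr rfl h, ← Finset.mul_sum, betaCoeff, alphaCoeff_add_four]
  field_simp

/-- The recurrence for the Taylor coefficients of `b = x / (1 - e^(-x))` that expresses the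
differential equation `x b' = b - b² + x b`. -/
theorem betaCoeff_recurrence (p : ℕ) :
    ((p : ℝ) + 2) * betaCoeff (p + 1)
      = betaCoeff p - ∑ k ∈ Finset.range p, betaCoeff (k + 1) * betaCoeff (p - k) := by
  match p with
  | 0 => norm_num [betaCoeff_zero, betaCoeff_one]
  | 1 => norm_num [betaCoeff_one, betaCoeff_two]
  | 2 => norm_num [betaCoeff_one, betaCoeff_two, betaCoeff_three, Finset.sum_range_succ]
  | k + 3 =>
    have h := betaCoeff_add_four k
    -- the first and the last term of the sum are `β_1 β_p = β_p / 2` each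
    rw [Finset.sum_range_succ, Finset.sum_range_succ', show k + 3 - (k + 2) = 1 by omega,
      Nat.sub_zero, zero_add, betaCoeff_one]
    have hs : ∑ j ∈ Finset.range (k + 1), betaCoeff (j + 1 + 1) * betaCoeff (k + 3 - (j + 1))
        = ∑ j ∈ Finset.range (k + 1), betaCoeff (j + 2) * betaCoeff (k + 2 - j) :=
      Finset.sum_congr rfl fun j _ => by rw [show k + 3 - (j + 1) = k + 2 - j by omega]
    rw [hs]
    push_cast
    linear_combination h

/-! ### The charge and its nilpotency -/

/-- The closed form of the terms of the charge: `Ω^(0) = G_a η^a` and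
`Ω^(l+1) = β_(l+1) W_l`. -/
def chargeClosedForm (m : ℕ) : ℕ → ExtAlg (m + 1)
  | 0 => ∑ a, G a * eta a
  | l + 1 => (betaCoeff (l + 1) : ℂ) • chargeTerm m l

theorem origBracket_succ_succ (i j : ℕ) :
    origBracket (selfRep m) (chargeClosedForm m (i + 1)) (chargeClosedForm m (j + 1)) = 0 := by
  rw [chargeClosedForm, chargeClosedForm, origBracket_smul_smul, origBracket_chargeTerm_chargeTerm,
    smul_zero]

theorem origBracket_zero_succ (l : ℕ) :
    origBracket (selfRep m) (chargeClosedForm m 0) (chargeClosedForm m (l + 1))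
      = (betaCoeff (l + 1) : ℂ) • obstructionTerm m (l + 1) := by
  have h := origBracket_smul_smul (selfRep m) 1 (betaCoeff (l + 1)) (∑ a, G a * eta a)
    (chargeTerm m l)
  rwa [one_smul, one_mul, origBracket_ghostCharge_chargeTerm] at h

theorem origBracket_succ_zero (l : ℕ) :
    origBracket (selfRep m) (chargeClosedForm m (l + 1)) (chargeClosedForm m 0)
      = (betaCoeff (l + 1) : ℂ) • obstructionTerm m (l + 1) := by
  have h := origBracket_smul_smul (selfRep m) (betaCoeff (l + 1)) 1 (chargeTerm m l)
    (∑ a, G a * eta a)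
  rwa [one_smul, mul_one, origBracket_chargeTerm_ghostCharge] at h

theorem ghostBracket_succ_succ (i j : ℕ) :
    ghostBracket (chargeClosedForm m (i + 1)) (chargeClosedForm m (j + 1))
      = (-2 : ℂ) • ((betaCoeff (i + 1) : ℂ) * betaCoeff (j + 1)) •
        obstructionTerm m (i + j + 1) := by
  rw [chargeClosedForm, chargeClosedForm, ghostBracket_smul_smul,
    ghostBracket_chargeTerm_chargeTerm, smul_comm]

theorem ghostBracket_zero_succ (l : ℕ) :
    ghostBracket (chargeClosedForm m 0) (chargeClosedForm m (l + 1))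
      = -((betaCoeff (l + 1) * ((l : ℂ) + 2)) • obstructionTerm m l) := by
  rw [chargeClosedForm, chargeClosedForm, ghostBracket_ghostCharge_left, map_smul,
    koszul_chargeTerm, smul_smul]

theorem ghostBracket_succ_zero (l : ℕ) :
    ghostBracket (chargeClosedForm m (l + 1)) (chargeClosedForm m 0)
      = -((betaCoeff (l + 1) * ((l : ℂ) + 2)) • obstructionTerm m l) := by
  rw [chargeClosedForm, chargeClosedForm, ghostBracket_ghostCharge_right, map_smul,
    koszul_chargeTerm, smul_smul]
  rw [map_smul, paritySign_chargeTerm, smul_neg]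

theorem betaCoeff_recurrence_complex (p : ℕ) :
    ((p : ℂ) + 2) * betaCoeff (p + 1) = betaCoeff p
      - ∑ k ∈ Finset.range p, (betaCoeff (k + 1) * betaCoeff (p - k) : ℂ) := by
  exact_mod_cast congrArg Complex.ofReal (betaCoeff_recurrence p)

theorem obstruction_chargeClosedForm (p : ℕ) :
    obstruction (selfRep m) (chargeClosedForm m) p
      = (((p : ℂ) + 2) * betaCoeff (p + 1)) • obstructionTerm m p := by
  rw [obstruction,
    ← Finset.sum_range fun k => origBracket (selfRep m) (chargeClosedForm m k)
      (chargeClosedForm m (p - k)),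
    ← Finset.sum_range fun k => ghostBracket (chargeClosedForm m (k + 1))
      (chargeClosedForm m (p - k))]
  have hg : ∑ k ∈ Finset.range p, ghostBracket (chargeClosedForm m (k + 1))
      (chargeClosedForm m (p - k)) = (-2 : ℂ) •
        (∑ k ∈ Finset.range p, (betaCoeff (k + 1) * betaCoeff (p - k) : ℂ)) •
          obstructionTerm m p := by
    rw [Finset.sum_smul, Finset.smul_sum]
    refine Finset.sum_congr rfl fun k hk => ?_
    have hkp := Finset.mem_range.1 hk
    obtain ⟨j, rfl⟩ := Nat.exists_eq_add_of_lt hkp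
    rw [show k + j + 1 - k = j + 1 by omega, ghostBracket_succ_succ]
  rw [hg]
  cases p with
  | zero =>
    have h0 : origBracket (selfRep m) (chargeClosedForm m 0) (chargeClosedForm m 0)
        = (2 : ℂ) • obstructionTerm m 0 := origBracket_ghostCharge_ghostCharge
    simp only [zero_add, Finset.sum_range_one, h0, Finset.sum_range_zero, Nat.sub_self, zero_smul,
      betaCoeff_one]
    push_cast
    module
  | succ q =>
    rw [betaCoeff_recurrence_complex, Finset.sum_range_succ, Finset.sum_range_succ',
      Nat.sub_self, Nat.sub_zero, origBracket_zero_succ, origBracket_succ_zero, Finset.sum_eq_zero]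
    · module
    · intro k hk
      have hkq := Finset.mem_range.1 hk
      rw [show q + 1 - (k + 1) = q - k - 1 + 1 by omega, origBracket_succ_succ]

theorem covariantOmega_selfRep (k : ℕ) :
    covariantOmega (selfRep m) k = chargeClosedForm m k := by
  induction k using Nat.strong_induction_on with
  | _ k ih =>
    cases k with
    | zero => rw [covariantOmega_zero, chargeClosedForm]
    | succ p =>
      have h : obstruction (selfRep m) (covariantOmega (selfRep m)) p
          = obstruction (selfRep m) (chargeClosedForm m) p := by
        rw [obstruction, obstruction]
        congr 2
        · refine Finset.sum_congr rfl fun k _ => ?_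
          rw [ih k (by omega), ih (p - k) (by omega)]
        · refine Finset.sum_congr rfl fun k _ => ?_
          rw [ih (k + 1) (by omega), ih (p - k) (by omega)]
      have hp : ((2 + p : ℕ) : ℂ) ≠ 0 := by
        rw [Nat.cast_ne_zero]
        omega
      rw [covariantOmega_succ, h, obstruction_chargeClosedForm, weightedHomotopy_of_mem
        (Submodule.smul_mem _ _ (obstructionTerm_mem_bihomogeneous p)), homotopy_smul,
        homotopy_obstructionTerm, smul_neg, smul_neg, neg_neg, smul_smul, chargeClosedForm]
      congr 1
      rw [show (p : ℂ) + 2 = ((2 + p : ℕ) : ℂ) by push_cast; ring, inv_mul_cancel_left₀ hp]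

theorem chargeClosedForm_eq_zero {k : ℕ} (hk : m + 1 ≤ k) : chargeClosedForm m k = 0 := by
  obtain ⟨l, rfl⟩ := Nat.exists_eq_add_of_le' (Nat.one_le_of_lt hk)
  rw [chargeClosedForm, chargeTerm_eq_zero (by omega), smul_zero]

theorem extBracket_chargeClosedForm_self :
    extBracket (selfRep m) (∑ k ∈ Finset.range (m + 1), chargeClosedForm m k)
      (∑ k ∈ Finset.range (m + 1), chargeClosedForm m k) = 0 := by
  have h00 : extBracket (selfRep m) (chargeClosedForm m 0) (chargeClosedForm m 0)
      = (2 : ℂ) • obstructionTerm m 0 := by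
    rw [chargeClosedForm, extBracket, origBracket_ghostCharge_ghostCharge,
      ghostBracket_ghostCharge_ghostCharge, add_zero]
  have h01 (l : ℕ) : extBracket (selfRep m) (chargeClosedForm m 0) (chargeClosedForm m (l + 1))
      = (betaCoeff (l + 1) : ℂ) • obstructionTerm m (l + 1)
        - (((l : ℂ) + 2) * betaCoeff (l + 1)) • obstructionTerm m l := by
    rw [extBracket, origBracket_zero_succ, ghostBracket_zero_succ, mul_comm, sub_eq_add_neg]
  have h10 (l : ℕ) : extBracket (selfRep m) (chargeClosedForm m (l + 1)) (chargeClosedForm m 0)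
      = (betaCoeff (l + 1) : ℂ) • obstructionTerm m (l + 1)
        - (((l : ℂ) + 2) * betaCoeff (l + 1)) • obstructionTerm m l := by
    rw [extBracket, origBracket_succ_zero, ghostBracket_succ_zero, mul_comm, sub_eq_add_neg]
  have h11 (i j : ℕ) : extBracket (selfRep m) (chargeClosedForm m (i + 1))
      (chargeClosedForm m (j + 1))
      = (-2 : ℂ) • ((betaCoeff (i + 1) : ℂ) * betaCoeff (j + 1)) •
        obstructionTerm m (i + j + 1) := by
    rw [extBracket, origBracket_succ_succ, ghostBracket_succ_succ, zero_add]
  -- the double sum, reordered by the total degree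
  have hdouble : ∑ i ∈ Finset.range m, ∑ j ∈ Finset.range m,
      ((betaCoeff (i + 1) : ℂ) * betaCoeff (j + 1)) • obstructionTerm m (i + j + 1)
      = ∑ p ∈ Finset.range m, (∑ k ∈ Finset.range p,
          (betaCoeff (k + 1) * betaCoeff (p - k) : ℂ)) • obstructionTerm m p := by
    have hflip := Finset.sum_range_diag_flip m fun i j =>
      ((betaCoeff (i + 1) : ℂ) * betaCoeff (j + 1)) • obstructionTerm m (i + j + 1)
    have h1 : ∑ i ∈ Finset.range m, ∑ j ∈ Finset.range m,
        ((betaCoeff (i + 1) : ℂ) * betaCoeff (j + 1)) • obstructionTerm m (i + j + 1)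
        = ∑ i ∈ Finset.range m, ∑ j ∈ Finset.range (m - i),
        ((betaCoeff (i + 1) : ℂ) * betaCoeff (j + 1)) • obstructionTerm m (i + j + 1) := by
      refine Finset.sum_congr rfl fun i _ => (Finset.sum_subset ?_ ?_).symm
      · exact Finset.range_subset_range.2 (Nat.sub_le _ _)
      · intro j _ hj
        rw [Finset.mem_range, not_lt] at hj
        rw [obstructionTerm_eq_zero (by omega), smul_zero]
    have h2 := Finset.sum_range_succ (fun p => (∑ k ∈ Finset.range p,
      (betaCoeff (k + 1) * betaCoeff (p - k) : ℂ)) • obstructionTerm m p) m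
    rw [obstructionTerm_eq_zero le_rfl, smul_zero, add_zero, Finset.sum_range_succ',
      Finset.sum_range_zero, zero_smul, add_zero] at h2
    rw [h1, ← hflip, ← h2]
    refine Finset.sum_congr rfl fun q _ => ?_
    rw [Finset.sum_smul]
    refine Finset.sum_congr rfl fun k hk => ?_
    have := Finset.mem_range.1 hk
    rw [show q + 1 - k = q - k + 1 by omega, Nat.add_sub_cancel' (by omega)]
  have hshift : ∑ p ∈ Finset.range m, (betaCoeff p : ℂ) • obstructionTerm m p
      = ∑ l ∈ Finset.range m, (betaCoeff (l + 1) : ℂ) • obstructionTerm m (l + 1)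
        + obstructionTerm m 0 := by
    have h := Finset.sum_range_succ (fun p => (betaCoeff p : ℂ) • obstructionTerm m p) m
    rw [obstructionTerm_eq_zero le_rfl, smul_zero, add_zero, Finset.sum_range_succ', betaCoeff_zero,
      Complex.ofReal_one, one_smul] at h
    exact h.symm
  have hrec : ∑ l ∈ Finset.range m, (((l : ℂ) + 2) * betaCoeff (l + 1)) • obstructionTerm m l
      = ∑ p ∈ Finset.range m, (betaCoeff p : ℂ) • obstructionTerm m p
        - ∑ p ∈ Finset.range m, (∑ k ∈ Finset.range p,
          (betaCoeff (k + 1) * betaCoeff (p - k) : ℂ)) • obstructionTerm m p := by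
    rw [← Finset.sum_sub_distrib]
    refine Finset.sum_congr rfl fun p _ => ?_
    rw [betaCoeff_recurrence_complex]
    module
  change extBracketₗ (selfRep m) _ _ = 0
  rw [LinearMap.map_sum₂]
  simp only [map_sum]
  change ∑ i ∈ Finset.range (m + 1), ∑ j ∈ Finset.range (m + 1),
    extBracket (selfRep m) (chargeClosedForm m i) (chargeClosedForm m j) = 0
  simp only [Finset.sum_range_succ' _ m, h00, h01, h10, h11, Finset.sum_add_distrib,
    Finset.sum_sub_distrib, ← Finset.smul_sum, hdouble, hrec, hshift]
  module

/-! ### The Poisson algebra -/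

/-- The derivation `G_1 ∂/∂G_1`. -/
def euler₁ (m : ℕ) : Derivation ℂ (GenPoly (m + 1)) (GenPoly (m + 1)) :=
  MvPolynomial.mkDerivation ℂ (Fin.cons (MvPolynomial.X 0) fun _ => 0)

/-- The derivation `∑_{α ≥ 2} G_α ∂/∂G_α`. -/
def euler₂ (m : ℕ) : Derivation ℂ (GenPoly (m + 1)) (GenPoly (m + 1)) :=
  MvPolynomial.mkDerivation ℂ (Fin.cons 0 fun i => MvPolynomial.X i.succ)

theorem euler_commute (f : GenPoly (m + 1)) : euler₁ m (euler₂ m f) = euler₂ m (euler₁ m f) := by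
  have h : ⁅euler₁ m, euler₂ m⁆ = 0 := by
    refine MvPolynomial.derivation_ext fun i => ?_
    rw [Derivation.commutator_apply]
    refine Fin.cases ?_ (fun j => ?_) i <;>
      simp [euler₁, euler₂, MvPolynomial.mkDerivation_X]
  have := congrArg (fun D : Derivation ℂ (GenPoly (m + 1)) (GenPoly (m + 1)) => D f) h
  rw [Derivation.commutator_apply] at this
  exact sub_eq_zero.1 this

theorem euler₁_apply (f : GenPoly (m + 1)) :
    euler₁ m f = MvPolynomial.pderiv 0 f * MvPolynomial.X 0 := by
  have h : euler₁ m = (MvPolynomial.X 0 : GenPoly (m + 1)) • MvPolynomial.pderiv 0 := by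
    refine MvPolynomial.derivation_ext fun i => ?_
    refine Fin.cases ?_ (fun j => ?_) i <;>
      simp [euler₁, MvPolynomial.mkDerivation_X, MvPolynomial.pderiv_X]
  rw [h, Derivation.smul_apply, smul_eq_mul, mul_comm]

theorem euler₂_apply (f : GenPoly (m + 1)) :
    euler₂ m f = ∑ i : Fin m, MvPolynomial.pderiv i.succ f * MvPolynomial.X i.succ := by
  have hsum (g : GenPoly (m + 1)) : (∑ i : Fin m, (MvPolynomial.X i.succ : GenPoly (m + 1)) •
      MvPolynomial.pderiv (R := ℂ) i.succ) g
      = ∑ i : Fin m, MvPolynomial.pderiv i.succ g * MvPolynomial.X i.succ := by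
    have := congrFun (map_sum (Derivation.coeFnAddMonoidHom (R := ℂ) (A := GenPoly (m + 1))
      (M := GenPoly (m + 1))) (fun i : Fin m => (MvPolynomial.X i.succ : GenPoly (m + 1)) •
      MvPolynomial.pderiv (R := ℂ) i.succ) Finset.univ) g
    rw [Finset.sum_apply] at this
    refine this.trans (Finset.sum_congr rfl fun i _ => ?_)
    exact mul_comm _ _
  have h : euler₂ m = ∑ i : Fin m,
      (MvPolynomial.X i.succ : GenPoly (m + 1)) • MvPolynomial.pderiv i.succ := by
    refine MvPolynomial.derivation_ext fun i => ?_
    rw [hsum]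
    refine Fin.cases ?_ (fun j => ?_) i
    · simp [euler₂, MvPolynomial.mkDerivation_X, MvPolynomial.pderiv_X,
        (Fin.succ_ne_zero _).symm]
    · simp [euler₂, MvPolynomial.mkDerivation_X, MvPolynomial.pderiv_X, Pi.single_apply]
  rw [h, hsum]

/-- The bracket is the wedge of two commuting derivations. -/
theorem polyBracket_selfRep (f g : GenPoly (m + 1)) :
    polyBracket (selfRep m) f g = euler₁ m f * euler₂ m g - euler₂ m f * euler₁ m g := by
  rw [polyBracket, Fin.sum_univ_succ, Fin.sum_univ_succ]
  simp only [Fin.sum_univ_succ (n := m), selfRep, Fin.succ_ne_zero, ne_eq, not_true_eq_false,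
    and_false, and_true, not_false_eq_true, if_true, if_false, mul_zero, Finset.sum_const_zero,
    zero_add, add_zero]
  rw [euler₁_apply, euler₂_apply, euler₁_apply, euler₂_apply, Finset.mul_sum, Finset.sum_mul,
    sub_eq_add_neg, ← Finset.sum_neg_distrib]
  refine congrArg₂ (· + ·) (Finset.sum_congr rfl fun i _ => ?_) (Finset.sum_congr rfl fun i _ => ?_)
  · ring
  · ring

theorem isFirstClassPoisson_selfRep (m : ℕ) : IsFirstClassPoisson (selfRep m) where
  antisymm a b := by
    unfold selfRep
    by_cases ha : a = 0 <;> by_cases hb : b = 0 <;> simp [ha, hb]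
  jacobi f g h := by
    simp only [polyBracket_selfRep, map_sub, Derivation.leibniz, smul_eq_mul, euler_commute]
    ring
  firstClass a b := by
    have hX (i : Fin (m + 1)) (f : GenPoly (m + 1)) : MvPolynomial.X i * f ∈
        Ideal.span (Set.range (MvPolynomial.X : Fin (m + 1) → GenPoly (m + 1))) :=
      Ideal.mul_mem_right _ _ (Ideal.subset_span ⟨i, rfl⟩)
    unfold selfRep
    split_ifs
    · exact hX _ _
    · exact Submodule.neg_mem _ (hX _ _)
    · exact Submodule.zero_mem _

theorem isQuadratic_selfRep (m : ℕ) : IsQuadratic (selfRep m) := by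
  intro a b
  have hX (i j : Fin (m + 1)) :
      (MvPolynomial.X i * MvPolynomial.X j : GenPoly (m + 1)).IsHomogeneous 2 :=
    (MvPolynomial.isHomogeneous_X ℂ i).mul (MvPolynomial.isHomogeneous_X ℂ j)
  unfold selfRep
  split_ifs
  · exact hX _ _
  · exact (hX _ _).neg
  · exact MvPolynomial.isHomogeneous_zero _ _ _

/-! ### Nonvanishing and the covariant rank -/

/-- A product of distinct ghosts is nonzero, since differentiating with respect to them in turn
gives `1`. -/
theorem prod_eta_ne_zero : ∀ L : List (Fin n), L.Nodup → (L.map eta).prod ≠ 0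
  | [], _ => by simp
  | a :: L, h => by
    intro h0
    rw [List.nodup_cons] at h
    have hd : ∀ L : List (Fin n), a ∉ L → dOdd (Sum.inl a) (L.map eta).prod = 0 := by
      intro L
      induction L with
      | nil => simp
      | cons b L ih =>
        intro hb
        rw [List.mem_cons, not_or] at hb
        rw [List.map_cons, List.prod_cons, eta_eq_odd, dOdd_odd_mul, ih hb.2, mul_zero,
          if_neg (by simpa using hb.1), sub_zero]
    have h1 := congrArg (dOdd (Sum.inl a)) h0
    rw [List.map_cons, List.prod_cons, eta_eq_odd, dOdd_odd_mul, if_pos rfl, hd L h.1, mul_zero,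
      sub_zero, map_zero] at h1
    exact prod_eta_ne_zero L h.2 h1

theorem dP_prod_eta_mul (a : Fin n) (x : ExtAlg n) :
    ∀ L : List (Fin n), dP a ((L.map eta).prod * x)
      = (-1 : ℂ) ^ L.length • ((L.map eta).prod * dP a x)
  | [] => by simp
  | b :: L => by
    rw [List.map_cons, List.prod_cons, mul_assoc, dP, eta_eq_odd, dOdd_odd_mul, if_neg (by simp),
      ← dP, dP_prod_eta_mul a x L, List.length_cons, pow_succ, mul_smul_comm, mul_assoc]
    module

/-- Differentiating with respect to a `P_α` trades a factor `N` for the ghost `η^α`. -/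
theorem prod_eta_mul_ghostPair_pow_ne_zero (k : ℕ) (L : List (Fin (m + 1))) (hL : L.Nodup)
    (h0 : 0 ∈ L) (hk : L.length + k ≤ m + 1) : (L.map eta).prod * ghostPair m ^ k ≠ 0 := by
  induction k generalizing L with
  | zero => simpa using prod_eta_ne_zero L hL
  | succ k ih =>
    intro h
    obtain ⟨a, ha⟩ : ∃ a, a ∉ L := by
      by_contra! hall
      have h1 : (Finset.univ : Finset (Fin (m + 1))).card ≤ L.length :=
        (Finset.card_le_card fun a _ => List.mem_toFinset.2 (hall a)).trans
          (List.toFinset_card_le L)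
      rw [Finset.card_univ, Fintype.card_fin] at h1
      omega
    obtain ⟨i, rfl⟩ := Fin.exists_succ_eq.2 (fun h => ha (h ▸ h0) : a ≠ 0)
    have hd := congrArg (dP i.succ) h
    rw [dP_prod_eta_mul, map_zero, dP, dOdd_ghostPair_pow, ← dP, dP_succ_ghostPair,
      Nat.add_sub_cancel, ext_neg_mul, smul_neg, ext_mul_neg, smul_neg, neg_eq_zero,
      smul_eq_zero_iff_right (pow_ne_zero _ (by norm_num)), mul_smul_comm,
      smul_eq_zero_iff_right (Nat.cast_ne_zero.2 k.succ_ne_zero), ← mul_assoc] at hd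
    refine ih (L ++ [i.succ]) ?_ (by simp [h0]) (by simp; omega) ?_
    · rw [List.nodup_append_comm]
      simpa using ⟨ha, hL⟩
    · simpa using hd

theorem chargeTerm_ne_zero {l : ℕ} (hl : l < m) : chargeTerm m l ≠ 0 := by
  intro h
  have h1 := congrArg (dG 0) h
  rw [dG_zero_chargeTerm, map_zero] at h1
  refine prod_eta_mul_ghostPair_pow_ne_zero (m := m) (l + 1) [0] (by simp) (by simp)
    (by simp; omega) ?_
  simpa using h1

theorem ghostCharge_ne_zero : ∑ a : Fin (m + 1), G a * eta a ≠ 0 := by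
  intro h
  have h1 := congrArg (dG 0) h
  rw [dG_ghostCharge, map_zero] at h1
  exact prod_eta_ne_zero [(0 : Fin (m + 1))] (by simp) (by simpa using h1)

theorem chargeClosedForm_ne_zero {k : ℕ} (hk : Even k) (hkm : k ≤ m) :
    chargeClosedForm m k ≠ 0 := by
  cases k with
  | zero => exact ghostCharge_ne_zero
  | succ l =>
    have hs : orderSign (l + 1) ≠ 0 := by
      intro h
      simpa [h] using orderSign_mul_self (l + 1)
    have hb : betaCoeff (l + 1) ≠ 0 := mul_ne_zero hs (alphaCoeff_even _ hk l.succ_pos).ne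
    exact smul_ne_zero (Complex.ofReal_ne_zero.2 hb) (chargeTerm_ne_zero hkm)

theorem chargeClosedForm_mem_bihomogeneous (k : ℕ) :
    chargeClosedForm m k ∈ bihomogeneous (m + 1) 1 k := by
  cases k with
  | zero => exact ghostCharge_mem_bihomogeneous
  | succ l => exact Submodule.smul_mem _ _ (chargeTerm_mem_bihomogeneous l)

theorem momentumPart_covariantCharge (j : ℕ) :
    momentumPart j (covariantCharge (selfRep m))
      = if j < m + 1 then chargeClosedForm m j else 0 := by
  simp only [covariantCharge, covariantOmega_selfRep, map_sum,
    momentumPart_of_mem (chargeClosedForm_mem_bihomogeneous _)]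
  rw [Finset.sum_ite_eq]
  simp only [Finset.mem_range]

theorem le_covariantRank {k : ℕ} (hk : Even k) (hkm : k ≤ m) :
    k ≤ covariantRank (selfRep m) := by
  refine le_csSup ⟨m, fun j hj => ?_⟩ ?_
  · by_contra hjm
    refine hj ?_
    rw [momentumPart_covariantCharge, if_neg (by omega)]
  · change momentumPart k _ ≠ 0
    rw [momentumPart_covariantCharge, if_pos (by omega)]
    exact chargeClosedForm_ne_zero hk hkm

theorem covariantOmega_selfRep_succ (l : ℕ) :
    covariantOmega (selfRep m) (l + 1)
      = (alphaCoeff (l + 1) : ℂ) • (T1 m (l + 1) + (-1 : ℂ) ^ (l + 1 + 1) • T2 m l) := by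
  rw [covariantOmega_selfRep, chargeClosedForm, T1_add_T2, smul_smul, betaCoeff, orderSign]
  push_cast
  rw [mul_comm]

end PoissonBRST

end

theorem mainTheorem2 :
    ∃ α : ℕ → ℝ,
      -- the coefficients and their recurrence
      (α 1 = -1 / 2 ∧ α 2 = -1 / 12 ∧ α 3 = 0 ∧
        ∀ k : ℕ, 3 < k →
          α k = -(1 / ((k : ℝ) + 1)) * ∑ l ∈ Finset.Icc 1 (k - 3), α (l + 1) * α (k - l - 1)) ∧
      -- their signs
      (∀ k : ℕ, Odd k → 1 < k → α k = 0) ∧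
      (∀ k : ℕ, Even k → 0 < k → α k < 0) ∧
      -- the algebra on `n = m + 1` generators and its covariant BRST charge
      (∀ m : ℕ,
        PoissonBRST.IsFirstClassPoisson (PoissonBRST.selfRep m) ∧
        PoissonBRST.IsQuadratic (PoissonBRST.selfRep m) ∧
        PoissonBRST.covariantOmega (PoissonBRST.selfRep m) 0
          = ∑ a, PoissonBRST.eta a * PoissonBRST.G a ∧
        (∀ l : ℕ, PoissonBRST.covariantOmega (PoissonBRST.selfRep m) (l + 1)
          = (α (l + 1) : ℂ) •
            (PoissonBRST.T1 m (l + 1) + (-1 : ℂ) ^ (l + 1 + 1) • PoissonBRST.T2 m l)) ∧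
        (∀ k : ℕ, m + 1 ≤ k → PoissonBRST.covariantOmega (PoissonBRST.selfRep m) k = 0) ∧
        PoissonBRST.extBracket (PoissonBRST.selfRep m)
          (PoissonBRST.covariantCharge (PoissonBRST.selfRep m))
          (PoissonBRST.covariantCharge (PoissonBRST.selfRep m)) = 0 ∧
        (∀ k : ℕ, Even k → k ≤ m →
          PoissonBRST.covariantOmega (PoissonBRST.selfRep m) k ≠ 0 ∧
          k ≤ PoissonBRST.covariantRank (PoissonBRST.selfRep m))) ∧
      -- arbitrarily high covariant rank
      (∀ r : ℕ, ∃ m : ℕ, r ≤ PoissonBRST.covariantRank (PoissonBRST.selfRep m)) := by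
  open PoissonBRST in
  refine ⟨alphaCoeff, ⟨alphaCoeff_one, alphaCoeff_two, alphaCoeff_three,
    fun k hk => alphaCoeff_of_three_lt hk⟩, alphaCoeff_odd, alphaCoeff_even, fun m =>
    ⟨isFirstClassPoisson_selfRep m, isQuadratic_selfRep m, ?_, covariantOmega_selfRep_succ, ?_, ?_,
      ?_⟩, fun r => ⟨2 * r, le_trans (by omega) (le_covariantRank (even_two_mul r) le_rfl)⟩⟩
  · rw [PoissonBRST.covariantOmega_zero]
    exact Finset.sum_congr rfl fun a _ => (PoissonBRST.commute_G a _).eq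
  · intro k hk
    rw [PoissonBRST.covariantOmega_selfRep, PoissonBRST.chargeClosedForm_eq_zero hk]
  · simp only [PoissonBRST.covariantCharge, PoissonBRST.covariantOmega_selfRep]
    exact PoissonBRST.extBracket_chargeClosedForm_self
  · intro k hk hkm
    rw [PoissonBRST.covariantOmega_selfRep]
    exact ⟨PoissonBRST.chargeClosedForm_ne_zero hk hkm, PoissonBRST.le_covariantRank hk hkm⟩
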